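/- Let $p$ be a prime and let $K$ be an ultrametric extension of $\mathbf{Q}_p$, that is, a field extension with an absolute value $|\cdot|$ extending that of $\mathbf{Q}_p$ ($K$ need not be complete). Let $R=\{x\in K : |x|\le 1\}$ be its ring of integers. Let $D\ge 1$ be an integer. For $1\le n\le D$ put $d_n=\lfloor\log_p(D/n)\rfloor$, that is, $d_n$ is the largest integer $e\geq 0$ with $np^{e}\le D$; put $d=d_1$. Let $\zeta$ be a root of unity of order $p^{d+1}$ in an extension $L$ of $K$ (for instance a finite one) with an absolute value extending that of $K$, and for $0\le e\le d$ put $\zeta_e=\zeta^{p^{d-e}}$, a root of unity of order $p^{e+1}$. Let $P(T)=\sum_{i=1}^D a_iT^i$ be any polynomial of degree at most $D$ with coefficients in $K$ and $P(0)=0$ (not necessarily $p$-typical), and let $$\widetilde P(T)=\sum_{i=1}^D\frac{a_i}{\zeta_{d_i}-1}\,T^i\in L[T].$$ Then the following are equivalent: 1. the radius of convergence of the power series $\exp(P(T))$ is at least $1$; 2. all coefficients of $\exp(P(T))$ lie in $R$; 3. the coefficients of $\exp(\widetilde P(T))$ of degree at most $D$ are integral, i.e. have absolute value at most $1$ in $L$.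 -/

import Mathlib

open PowerSeries Polynomial

noncomputable section

/-- The exponential `exp(f)` of a power series `f` without constant term: the composite of the
power series `∑ Tⁿ / n!` with `f`. -/
def expComp {F : Type*} [Field F] [CharZero F] (f : F⟦X⟧) : F⟦X⟧ :=
  (PowerSeries.exp F).subst f

/-- The radius of convergence, in `[0, ∞]`, of a power series over an ultrametric field. -/
def convRadius {F : Type*} [NontriviallyNormedField F] (f : F⟦X⟧) : ENNReal :=
  (FormalMultilinearSeries.ofScalars F (fun n : ℕ => PowerSeries.coeff n f)).radius

/-- The number `d_n = ⌊log_p (D / n)⌋`, for `1 ≤ n ≤ D`; see `le_wittLen_iff`. -/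
def wittLen (p D n : ℕ) : ℕ := Nat.log p (D / n)

/-- `d_n` is the largest integer `e` with `n * p ^ e ≤ D`. -/
theorem le_wittLen_iff {p D n e : ℕ} (hp : 1 < p) (hn : 1 ≤ n) (hnD : n ≤ D) :
    e ≤ wittLen p D n ↔ n * p ^ e ≤ D := by
  have h : D / n ≠ 0 := (Nat.div_pos hnD hn).ne'
  rw [wittLen, Nat.le_log_iff_pow_le hp h, Nat.le_div_iff_mul_le hn, mul_comm]

/-- With `d = d_1` and `ζ` a root of unity of order `p ^ (d + 1)`, the root of unity
`ζ_e = ζ ^ (p ^ (d - e))`, of order `p ^ (e + 1)`, for `0 ≤ e ≤ d`. -/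
def zetaAt {F : Type*} [Field F] (p D : ℕ) (ζ : F) (e : ℕ) : F :=
  ζ ^ p ^ (wittLen p D 1 - e)

theorem zetaAt_isPrimitiveRoot {F : Type*} [Field F] {p D : ℕ} (hp : 0 < p) {ζ : F}
    (hζ : IsPrimitiveRoot ζ (p ^ (wittLen p D 1 + 1))) {e : ℕ} (he : e ≤ wittLen p D 1) :
    IsPrimitiveRoot (zetaAt p D ζ e) (p ^ (e + 1)) := by
  refine hζ.pow (pow_pos hp _) ?_
  rw [← pow_add]
  congr 1
  omega

/-- For `P = ∑ a_i T^i`, the polynomial `P̃ = ∑_{i=1}^D a_i / (ζ_{d_i} - 1) T^i`. -/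
def tildePoly {K L : Type*} [Field K] [Field L] [Algebra K L] (p D : ℕ) (ζ : L)
    (P : K[X]) : L[X] :=
  ∑ i ∈ Finset.Icc 1 D,
    Polynomial.monomial i (algebraMap K L (P.coeff i) / (zetaAt p D ζ (wittLen p D i) - 1))

end

noncomputable section

/-! Let A(T) = ∑ T^(p^k)/p^k and let E = exp(A) be the Artin–Hasse exponential, which has p-integral
coefficients (`norm_coeff_artinHasse_padic_le`). Up to degree D one can write P̃ as ∑ A(x_m T^m),
and integrality of E shows that exp(P̃) is integral up to degree D exactly when every |x_m| ≤ 1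
(`norm_coeff_expComp_le_iff`).

Passing from P̃ back to P multiplies the coefficient of T^(m p^k) by ζ_{d_{m p^k}} - 1 =
ζ_{d_m}^(p^k) - 1, so it turns A(x_m T^m) into A(ζ_{d_m} x_m T^m) - A(x_m T^m). The terms of this
difference beyond degree D vanish, because ζ_{d_m}^(p^k) = 1 there. Thus P is exactly a finite sum
of such differences (`eq_sum_pulitaLog`), and exp(P) is the product of the series E(ζ_{d_m} x_m
T^m)/E(x_m T^m). Integral x_m therefore make exp(P) integral, and integral coefficients give radius
at least 1.

Conversely, suppose some |x_m| > 1 and take r < 1 with |x_m| r^m ≤ 1 for all m and equality for some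
m. Factors without equality stay bounded slightly beyond r and can be divided out. Let e be the
largest d_m among the others, and multiply their logarithms by p^e. At radius r, only the terms π
x_m^(p^e) T^(m p^e) with d_m = e reach size |π|, where π = ζ_0 - 1 and |π|^(p-1) = |p|
(`norm_coeff_nsmul_pulitaLog_sub_lt`); the rest has a bounded exponential slightly beyond r. So if
exp(P) converged on the open unit disc, exp(π g) would be bounded beyond r, with g the sum of the
x_m^(p^e) T^(m p^e). But with N = deg g, the coefficient of degree N p^k of exp(π g) has weight
exactly |π| at r for every k (`norm_coeff_expComp_mul_pow_eq`), a contradiction. -/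

theorem hasSubst_of_coeff_zero {F : Type*} [Field F] {f : F⟦X⟧} (hf : PowerSeries.constantCoeff f = 0) :
    PowerSeries.HasSubst f := PowerSeries.HasSubst.of_constantCoeff_zero' hf

theorem constantCoeff_finset_sum {F ι : Type*} [Field F] (s : Finset ι) {f : ι → F⟦X⟧}
    (hf : ∀ i ∈ s, PowerSeries.constantCoeff (f i) = 0) :
    PowerSeries.constantCoeff (∑ i ∈ s, f i) = 0 := by
  rw [map_sum, Finset.sum_eq_zero hf]

theorem constantCoeff_map_eq_zero {E F : Type*} [Field E] [Field F] (φ : E →+* F) {f : E⟦X⟧}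
    (hf : PowerSeries.constantCoeff f = 0) :
    PowerSeries.constantCoeff (PowerSeries.map φ f) = 0 := by
  rw [← PowerSeries.coeff_zero_eq_constantCoeff_apply, PowerSeries.coeff_map,
    PowerSeries.coeff_zero_eq_constantCoeff_apply, hf, map_zero]

/-! ### Formal exponentials of series without constant term. -/

section ExpAlgebra

variable {F : Type*} [Field F] [CharZero F]

theorem derivative_expComp {f : F⟦X⟧} (hf : PowerSeries.constantCoeff f = 0) :
    d⁄dX F (expComp f) = expComp f * d⁄dX F f := by
  rw [expComp, PowerSeries.derivative_subst (hasSubst_of_coeff_zero hf),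
    PowerSeries.derivative_exp]

theorem coeff_expComp {f : F⟦X⟧} (hf : PowerSeries.constantCoeff f = 0) (m : ℕ) :
    PowerSeries.coeff m (expComp f) =
      ∑ n ∈ Finset.range (m + 1), PowerSeries.coeff m (f ^ n) / (n.factorial : F) := by
  rw [expComp, PowerSeries.coeff_subst' (hasSubst_of_coeff_zero hf),
    finsum_eq_sum_of_support_subset (s := Finset.range (m + 1))]
  · refine Finset.sum_congr rfl fun n _ => ?_
    simp [PowerSeries.coeff_exp, div_eq_inv_mul]
  · intro n hn
    by_contra h
    simp only [Finset.coe_range, Set.mem_Iio, not_lt] at h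
    refine hn ?_
    have : PowerSeries.coeff m (f ^ n) = 0 := by
      refine PowerSeries.coeff_of_lt_order _ ?_
      refine lt_of_lt_of_le ?_ (PowerSeries.le_order_pow_of_constantCoeff_eq_zero n hf)
      exact_mod_cast h
    simp [this]

theorem constantCoeff_expComp {f : F⟦X⟧} (hf : PowerSeries.constantCoeff f = 0) :
    PowerSeries.constantCoeff (expComp f) = 1 := by
  rw [← PowerSeries.coeff_zero_eq_constantCoeff_apply, coeff_expComp hf]
  simp

theorem expComp_zero : expComp (0 : F⟦X⟧) = 1 := by
  ext m
  rw [coeff_expComp (map_zero _), Finset.sum_range_succ']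
  simp [PowerSeries.coeff_one]

/-- In characteristic zero a series is determined by its derivative and constant term; the same
principle gives additivity below. -/
theorem expComp_mul_expComp_neg {f : F⟦X⟧} (hf : PowerSeries.constantCoeff f = 0) :
    expComp f * expComp (-f) = 1 := by
  have hf' : PowerSeries.constantCoeff (-f) = 0 := by simp [hf]
  refine PowerSeries.derivative.ext ?_ ?_
  · rw [Derivation.leibniz, derivative_expComp hf, derivative_expComp hf']
    simp only [smul_eq_mul, map_neg, PowerSeries.derivative_one]
    ring
  · simp [constantCoeff_expComp hf, constantCoeff_expComp hf']

theorem expComp_add {f g : F⟦X⟧} (hf : PowerSeries.constantCoeff f = 0)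
    (hg : PowerSeries.constantCoeff g = 0) :
    expComp (f + g) = expComp f * expComp g := by
  have hf' : PowerSeries.constantCoeff (-f) = 0 := by simp [hf]
  have hg' : PowerSeries.constantCoeff (-g) = 0 := by simp [hg]
  have hfg : PowerSeries.constantCoeff (f + g) = 0 := by simp [hf, hg]
  have key : expComp (f + g) * (expComp (-f) * expComp (-g)) = 1 := by
    refine PowerSeries.derivative.ext ?_ ?_
    · simp only [Derivation.leibniz, derivative_expComp hf', derivative_expComp hg',
        derivative_expComp hfg, smul_eq_mul, map_neg, map_add, PowerSeries.derivative_one]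
      ring
    · simp [constantCoeff_expComp hf', constantCoeff_expComp hg', constantCoeff_expComp hfg]
  have h1 := expComp_mul_expComp_neg hf
  have h2 := expComp_mul_expComp_neg hg
  linear_combination (expComp f * expComp g) * key
    - expComp (f + g) * expComp g * expComp (-g) * h1 - expComp (f + g) * h2

theorem expComp_sum {ι : Type*} (s : Finset ι) {f : ι → F⟦X⟧}
    (hf : ∀ i ∈ s, PowerSeries.constantCoeff (f i) = 0) :
    expComp (∑ i ∈ s, f i) = ∏ i ∈ s, expComp (f i) := by
  classical
  induction s using Finset.induction_on with
  | empty => simp [expComp_zero]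
  | insert a s ha ih =>
    have hs : ∀ i ∈ s, PowerSeries.constantCoeff (f i) = 0 :=
      fun i hi => hf i (Finset.mem_insert_of_mem hi)
    rw [Finset.sum_insert ha, Finset.prod_insert ha, expComp_add
      (hf a (Finset.mem_insert_self _ _)) (constantCoeff_finset_sum s hs), ih hs]

theorem expComp_nsmul {f : F⟦X⟧} (hf : PowerSeries.constantCoeff f = 0) (n : ℕ) :
    expComp (n • f) = expComp f ^ n := by
  simpa using expComp_sum (Finset.range n) (f := fun _ => f) fun _ _ => hf

/-- If all coefficients of `f` of degree `< m` vanish, then `exp(f) = 1 + f_m T^m + ⋯`. -/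
theorem coeff_expComp_of_coeff_eq_zero {f : F⟦X⟧} {m : ℕ} (hm : 0 < m)
    (hf : ∀ i < m, PowerSeries.coeff i f = 0) {j : ℕ} (hj0 : 0 < j) (hj : j ≤ m) :
    PowerSeries.coeff j (expComp f) = PowerSeries.coeff j f := by
  have hf0 : PowerSeries.constantCoeff f = 0 := by
    rw [← PowerSeries.coeff_zero_eq_constantCoeff_apply, hf 0 hm]
  have ho : (m : ℕ∞) ≤ f.order := PowerSeries.nat_le_order _ _ hf
  obtain ⟨j, rfl⟩ : ∃ i, j = i + 1 := ⟨j - 1, by omega⟩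
  rw [coeff_expComp hf0, Finset.sum_range_succ', Finset.sum_range_succ']
  rw [Finset.sum_eq_zero]
  · simp [PowerSeries.coeff_one]
  intro n _
  have : PowerSeries.coeff (j + 1) (f ^ (n + 1 + 1)) = 0 := by
    refine PowerSeries.coeff_of_lt_order _ (lt_of_lt_of_le ?_ (PowerSeries.le_order_pow _ _))
    calc ((j + 1 : ℕ) : ℕ∞) < ((2 * m : ℕ) : ℕ∞) := by exact_mod_cast (by omega)
      _ = 2 • (m : ℕ∞) := by simp
      _ ≤ (n + 1 + 1) • (m : ℕ∞) := nsmul_le_nsmul_left (zero_le) (by omega)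
      _ ≤ _ := nsmul_le_nsmul_right ho _
  simp [this]

/-- exp(g) = exp(f) exp(g - f), and the second factor is 1 up to degree m. -/
theorem coeff_expComp_congr {f g : F⟦X⟧} (hf0 : PowerSeries.constantCoeff f = 0) {m : ℕ}
    (h : ∀ i ≤ m, PowerSeries.coeff i f = PowerSeries.coeff i g) {j : ℕ} (hj : j ≤ m) :
    PowerSeries.coeff j (expComp f) = PowerSeries.coeff j (expComp g) := by
  have hz : ∀ i < m + 1, PowerSeries.coeff i (g - f) = 0 := fun i hi => by
    rw [map_sub, h i (by omega), sub_self]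
  have hgf : PowerSeries.constantCoeff (g - f) = 0 := by
    rw [← PowerSeries.coeff_zero_eq_constantCoeff_apply, hz 0 (by omega)]
  have : expComp g = expComp f * expComp (g - f) := by
    rw [← expComp_add hf0 hgf, add_sub_cancel]
  rw [this, PowerSeries.coeff_mul, Finset.sum_eq_single (j, 0)]
  · simp [constantCoeff_expComp hgf]
  · rintro ⟨a, b⟩ hab hne
    rw [Finset.HasAntidiagonal.mem_antidiagonal] at hab
    simp only at hab
    have hb : 0 < b := by
      rcases Nat.eq_zero_or_pos b with rfl | hb
      · exact absurd (by simp at hab; simp [hab]) hne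
      · exact hb
    rw [coeff_expComp_of_coeff_eq_zero (Nat.succ_pos m) hz hb (by omega), hz b (by omega),
      mul_zero]
  · intro hn
    exact absurd (by simp) hn

theorem map_expComp {E : Type*} [Field E] [CharZero E] (φ : E →+* F) {f : E⟦X⟧}
    (hf : PowerSeries.constantCoeff f = 0) :
    PowerSeries.map φ (expComp f) = expComp (PowerSeries.map φ f) := by
  ext m
  rw [PowerSeries.coeff_map, coeff_expComp hf, coeff_expComp (constantCoeff_map_eq_zero φ hf)]
  simp [← map_pow]

theorem expComp_expand_rescale {f : F⟦X⟧} (hf : PowerSeries.constantCoeff f = 0) (c : F) {m : ℕ}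
    (hm : m ≠ 0) :
    expComp (PowerSeries.expand m hm (PowerSeries.rescale c f)) =
      PowerSeries.expand m hm (PowerSeries.rescale c (expComp f)) := by
  have h0 : PowerSeries.constantCoeff (PowerSeries.rescale c f) = 0 := by
    rw [← PowerSeries.coeff_zero_eq_constantCoeff_apply, PowerSeries.coeff_rescale]
    simp [hf]
  rw [PowerSeries.expand_apply, PowerSeries.expand_apply, expComp, expComp,
    PowerSeries.rescale_eq_subst, PowerSeries.rescale_eq_subst,
    PowerSeries.subst_comp_subst_apply (hasSubst_of_coeff_zero hf)
      (PowerSeries.HasSubst.smul_X' c),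
    PowerSeries.subst_comp_subst_apply (a := PowerSeries.subst (c • PowerSeries.X) f)
      (b := PowerSeries.X ^ m) (by
        rw [← PowerSeries.rescale_eq_subst]; exact hasSubst_of_coeff_zero h0)
      (PowerSeries.HasSubst.X_pow hm)]

end ExpAlgebra
end

/-! ### Gauss-norm bounds on power series. -/

noncomputable section

/-- The power series `f` satisfies `|f_n| ρ ^ n ≤ c` for all `n`. -/
def GaussLE {L : Type*} [NormedField L] (ρ c : ℝ) (f : L⟦X⟧) : Prop :=
  ∀ n, ‖PowerSeries.coeff n f‖ * ρ ^ n ≤ c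

theorem gaussLE_one_left_iff {L : Type*} [NormedField L] {f : L⟦X⟧} :
    GaussLE 1 1 f ↔ ∀ n, ‖PowerSeries.coeff n f‖ ≤ 1 := by simp [GaussLE]

theorem gaussLE_one {L : Type*} [NormedField L] (ρ : ℝ) : GaussLE ρ 1 (1 : L⟦X⟧) := by
  intro n
  rw [PowerSeries.coeff_one]
  split_ifs with h <;> simp [h]

theorem GaussLE.neg {L : Type*} [NormedField L] {ρ c : ℝ} {f : L⟦X⟧} (hf : GaussLE ρ c f) :
    GaussLE ρ c (-f) := fun n => by simpa using hf n

/-- A bound at radius `‖c‖ ρ ^ m ≤ 1` for `f (c T ^ m)`. -/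
theorem GaussLE.expand_rescale {L : Type*} [NormedField L] {f : L⟦X⟧} (hf : GaussLE 1 1 f)
    {ρ : ℝ} (hρ : 0 ≤ ρ) {c : L} {m : ℕ} (hm : m ≠ 0) (hc : ‖c‖ * ρ ^ m ≤ 1) :
    GaussLE ρ 1 (PowerSeries.expand m hm (PowerSeries.rescale c f)) := by
  intro n
  rw [PowerSeries.coeff_expand]
  split_ifs with h
  · obtain ⟨k, rfl⟩ := h
    rw [Nat.mul_div_cancel_left _ (Nat.pos_of_ne_zero hm), PowerSeries.coeff_rescale, norm_mul,
      norm_pow, pow_mul]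
    have h1 := gaussLE_one_left_iff.mp hf k
    have h2 : (‖c‖ * ρ ^ m) ^ k ≤ 1 := pow_le_one₀ (by positivity) hc
    rw [mul_pow] at h2
    calc _ = ‖PowerSeries.coeff k f‖ * (‖c‖ ^ k * (ρ ^ m) ^ k) := by ring
      _ ≤ 1 := mul_le_one₀ h1 (by positivity) h2
  · simp

section Ultrametric

variable {L : Type*} [NormedField L] [IsUltrametricDist L] {ρ c c' : ℝ} {f g : L⟦X⟧}

theorem GaussLE.mul (hρ : 0 < ρ) (hc : 0 ≤ c) (hc' : 0 ≤ c') (hf : GaussLE ρ c f)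
    (hg : GaussLE ρ c' g) : GaussLE ρ (c * c') (f * g) := by
  intro n
  rw [PowerSeries.coeff_mul, ← le_div_iff₀ (pow_pos hρ n)]
  refine IsUltrametricDist.norm_sum_le_of_forall_le_of_nonneg (by positivity) ?_
  rintro ⟨a, b⟩ hab
  rw [Finset.HasAntidiagonal.mem_antidiagonal] at hab
  simp only at hab
  rw [le_div_iff₀ (pow_pos hρ n), ← hab, pow_add, norm_mul]
  calc _ = (‖PowerSeries.coeff a f‖ * ρ ^ a) * (‖PowerSeries.coeff b g‖ * ρ ^ b) := by ring
    _ ≤ _ := mul_le_mul (hf a) (hg b) (by positivity) hc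

theorem GaussLE.pow (hρ : 0 < ρ) (hc : 0 ≤ c) (hf : GaussLE ρ c f) (n : ℕ) :
    GaussLE ρ (c ^ n) (f ^ n) := by
  induction n with
  | zero => simpa using gaussLE_one ρ
  | succ n ih =>
    rw [pow_succ, pow_succ]
    exact ih.mul hρ (by positivity) hc hf

theorem GaussLE.prod (hρ : 0 < ρ) {ι : Type*} (s : Finset ι) {F : ι → L⟦X⟧}
    (hF : ∀ i ∈ s, GaussLE ρ 1 (F i)) : GaussLE ρ 1 (∏ i ∈ s, F i) := by
  classical
  induction s using Finset.induction_on with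
  | empty => simpa using gaussLE_one ρ
  | insert a s ha ih =>
    rw [Finset.prod_insert ha, ← mul_one (1 : ℝ)]
    exact (hF a (Finset.mem_insert_self _ _)).mul hρ zero_le_one zero_le_one
      (ih fun i hi => hF i (Finset.mem_insert_of_mem hi))

theorem GaussLE.sum (hρ : 0 < ρ) (hc : 0 ≤ c) {ι : Type*} (s : Finset ι) {F : ι → L⟦X⟧}
    (hF : ∀ i ∈ s, GaussLE ρ c (F i)) : GaussLE ρ c (∑ i ∈ s, F i) := by
  intro n
  rw [map_sum, ← le_div_iff₀ (pow_pos hρ n)]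
  refine IsUltrametricDist.norm_sum_le_of_forall_le_of_nonneg (by positivity) fun i hi => ?_
  rw [le_div_iff₀ (pow_pos hρ n)]
  exact hF i hi n

/-- As f has constant term 1, the coefficients of its inverse satisfy a recursion without division,
to which the ultrametric inequality applies. -/
theorem GaussLE.of_mul_eq_one (hρ : 0 < ρ) (hf : GaussLE ρ 1 f)
    (hf0 : PowerSeries.constantCoeff f = 1) (hfg : f * g = 1) : GaussLE ρ 1 g := by
  intro n
  induction n using Nat.strong_induction_on with
  | _ n ih =>
  have hc := congrArg (PowerSeries.coeff n) hfg
  rw [PowerSeries.coeff_mul] at hc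
  rcases n with _ | n
  · have : PowerSeries.coeff 0 g = 1 := by simpa [hf0] using hc
    simp [this]
  · rw [Finset.Nat.antidiagonal_succ, Finset.sum_cons, Finset.sum_map] at hc
    simp only [PowerSeries.coeff_zero_eq_constantCoeff_apply, hf0, one_mul, PowerSeries.coeff_one,
      Nat.succ_ne_zero, if_false, Function.Embedding.prodMap, Function.Embedding.coeFn_mk,
      Prod.map_fst, Prod.map_snd, Function.Embedding.refl_apply] at hc
    rw [eq_neg_of_add_eq_zero_left hc, norm_neg, ← le_div_iff₀ (pow_pos hρ _)]
    refine IsUltrametricDist.norm_sum_le_of_forall_le_of_nonneg (by positivity) ?_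
    rintro ⟨a, b⟩ hab
    rw [Finset.HasAntidiagonal.mem_antidiagonal] at hab
    simp only at hab
    rw [le_div_iff₀ (pow_pos hρ _), norm_mul]
    have h1 := hf (a + 1)
    have h2 := ih b (by omega)
    have h3 : n + 1 = (a + 1) + b := by omega
    rw [h3, pow_add]
    calc _ = (‖PowerSeries.coeff (a + 1) f‖ * ρ ^ (a + 1)) *
          (‖PowerSeries.coeff b g‖ * ρ ^ b) := by simp; ring
      _ ≤ 1 := mul_le_one₀ h1 (by positivity) h2

theorem GaussLE.expComp [CharZero L] (hρ : 0 < ρ) (hc : 0 ≤ c)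
    (hcf : ∀ n : ℕ, c ^ n ≤ ‖(n.factorial : L)‖) (hf0 : PowerSeries.constantCoeff f = 0)
    (hf : GaussLE ρ c f) : GaussLE ρ 1 (expComp f) := by
  intro m
  rw [coeff_expComp hf0, ← le_div_iff₀ (pow_pos hρ _)]
  refine IsUltrametricDist.norm_sum_le_of_forall_le_of_nonneg (by positivity) fun n _ => ?_
  have hn : 0 < ‖(n.factorial : L)‖ := by
    rw [norm_pos_iff]; exact_mod_cast n.factorial_ne_zero
  rw [le_div_iff₀ (pow_pos hρ _), norm_div, div_mul_eq_mul_div, div_le_one hn]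
  exact (hf.pow hρ hc n m).trans (hcf n)

end Ultrametric

/-! ### Absolute values of factorials. -/

section Padic

variable (p : ℕ) [hp : Fact p.Prime] {L : Type*} [NormedField L] [NormedAlgebra ℚ_[p] L]

theorem norm_natCast_eq_padic (n : ℕ) : ‖(n : L)‖ = ‖(n : ℚ_[p])‖ := by
  rw [← map_natCast (algebraMap ℚ_[p] L), norm_algebraMap']

/-- Since |π^n/n!| = |π|^s with s the digit sum of n, this singles out the powers of p as the
indices of the dominant terms of exp(π g). -/
theorem two_le_digits_sum {n : ℕ} (hn : n ≠ 0) (h : ∀ k, n ≠ p ^ k) : 2 ≤ (p.digits n).sum := by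
  induction n using Nat.strong_induction_on with
  | _ n ih =>
  have hp2 := hp.out.two_le
  have hdm := Nat.div_add_mod n p
  rw [Nat.digits_def' hp.out.one_lt (Nat.pos_of_ne_zero hn), List.sum_cons]
  by_cases hq : n / p = 0
  · rw [hq] at hdm ⊢
    have := h 0
    simp only [pow_zero] at this
    omega
  by_cases hk : ∃ k, n / p = p ^ k
  · obtain ⟨k, hk⟩ := hk
    have h1 : n % p ≠ 0 := by
      intro h0
      refine h (k + 1) ?_
      rw [← hdm, hk, h0, pow_succ]
      ring
    have h2 : (p.digits (n / p)).sum ≠ 0 := by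
      rw [Ne, List.sum_eq_zero_iff]
      intro h0
      have hne : p.digits (n / p) ≠ [] := Nat.digits_ne_nil_iff_ne_zero.mpr hq
      exact Nat.getLast_digit_ne_zero p hq (h0 _ (List.getLast_mem hne))
    omega
  · have := ih (n / p) (Nat.div_lt_self (Nat.pos_of_ne_zero hn) hp.out.one_lt) hq
      (not_exists.mp hk)
    omega

theorem norm_factorial_eq (n : ℕ) :
    ‖(n.factorial : L)‖ = ‖(p : L)‖ ^ padicValNat p n.factorial := by
  rw [norm_natCast_eq_padic p n.factorial, norm_natCast_eq_padic p p, Padic.norm_p,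
    ← Rat.cast_natCast, Padic.eq_padicNorm,
    padicNorm.eq_zpow_of_nonzero (by exact_mod_cast n.factorial_ne_zero)]
  simp [padicValRat.of_nat]

variable {p}

/-- Legendre's formula: (p - 1) v_p(n!) is n minus its digit sum in base p. -/
theorem norm_factorial_eq_pow {ω : ℝ} (hω : ω ^ (p - 1) = ‖(p : L)‖) (n : ℕ) :
    ‖(n.factorial : L)‖ = ω ^ (n - (p.digits n).sum) := by
  rw [norm_factorial_eq p, ← hω, ← pow_mul, sub_one_mul_padicValNat_factorial]

theorem pow_le_norm_factorial {ω : ℝ} (hω0 : 0 ≤ ω) (hω1 : ω ≤ 1)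
    (hω : ω ^ (p - 1) = ‖(p : L)‖) (n : ℕ) : ω ^ n ≤ ‖(n.factorial : L)‖ := by
  rw [norm_factorial_eq_pow hω]
  exact pow_le_pow_of_le_one hω0 hω1 (Nat.sub_le _ _)

theorem pow_div_norm_factorial {ω : ℝ} (hω0 : 0 < ω) (hω : ω ^ (p - 1) = ‖(p : L)‖) (n : ℕ) :
    ω ^ n / ‖(n.factorial : L)‖ = ω ^ (p.digits n).sum := by
  rw [norm_factorial_eq_pow hω, div_eq_iff (by positivity), ← pow_add,
    Nat.add_sub_cancel' (Nat.digit_sum_le p n)]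

theorem pow_prime_pow_div_norm_factorial {ω : ℝ} (hω0 : 0 < ω) (hω : ω ^ (p - 1) = ‖(p : L)‖)
    (k : ℕ) : ω ^ p ^ k / ‖((p ^ k).factorial : L)‖ = ω := by
  rw [pow_div_norm_factorial hω0 hω]
  have : (p.digits (p ^ k)).sum = 1 := by
    have h := Nat.digits_base_pow_mul (b := p) (k := k) (m := 1) hp.out.one_lt one_pos
    rw [mul_one] at h
    rw [h, Nat.digits_of_lt p 1 one_ne_zero hp.out.one_lt]
    simp
  rw [this, pow_one]

variable (p) in
theorem norm_prime_lt_one : ‖(p : L)‖ < 1 := by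
  rw [norm_natCast_eq_padic p]; exact Padic.norm_p_lt_one

variable (p) in
theorem norm_prime_pos : 0 < ‖(p : L)‖ := by
  rw [norm_natCast_eq_padic p, Padic.norm_p]
  have := hp.out.pos
  positivity

end Padic

/-! ### Distance to 1 of roots of unity of p-power order. -/

section RootsOfUnity

variable {p : ℕ} [hp : Fact p.Prime] {L : Type*} [NormedField L] [NormedAlgebra ℚ_[p] L]
  [IsUltrametricDist L]

theorem norm_eq_one_of_isPrimitiveRoot {L : Type*} [NormedField L] {ζ : L} {n : ℕ} (hn : n ≠ 0)
    (h : IsPrimitiveRoot ζ n) : ‖ζ‖ = 1 := by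
  have := congrArg norm h.pow_eq_one
  rw [norm_pow, norm_one] at this
  exact (pow_eq_one_iff_of_nonneg (norm_nonneg _) hn).mp this

theorem norm_pow_sub_one_le {ζ : L} (h : ‖ζ‖ ≤ 1) (i : ℕ) : ‖ζ ^ i - 1‖ ≤ ‖ζ - 1‖ := by
  rw [← geom_sum_mul, norm_mul]
  refine mul_le_of_le_one_left (norm_nonneg _) ?_
  refine IsUltrametricDist.norm_sum_le_of_forall_le_of_nonneg zero_le_one fun j _ => ?_
  rw [norm_pow]
  exact pow_le_one₀ (norm_nonneg _) h

-- p is the product of the 1 - ζ^k for 0 < k < p. These factors have equal norm, since ζ and ζ^k are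
-- powers of each other.
omit [NormedAlgebra ℚ_[p] L] in
theorem norm_sub_one_pow_eq {ζ : L} (hζ : IsPrimitiveRoot ζ p) :
    ‖ζ - 1‖ ^ (p - 1) = ‖(p : L)‖ := by
  have hp1 : p - 1 + 1 = p := Nat.sub_add_cancel hp.out.one_lt.le
  have hn := norm_eq_one_of_isPrimitiveRoot hp.out.ne_zero hζ
  have h := IsPrimitiveRoot.prod_one_sub_pow_eq_order (n := p - 1) (μ := ζ) (by rwa [hp1])
  have h' := congrArg norm h
  rw [norm_prod] at h'
  have hk : ∀ k ∈ Finset.range (p - 1), ‖1 - ζ ^ (k + 1)‖ = ‖ζ - 1‖ := by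
    intro k hk
    rw [Finset.mem_range] at hk
    rw [norm_sub_rev]
    refine le_antisymm (norm_pow_sub_one_le hn.le _) ?_
    have hcop : (k + 1).Coprime p :=
      (Nat.coprime_of_lt_prime (by omega) (by omega) hp.out).symm
    have hz := hζ.pow_of_coprime (k + 1) hcop
    obtain ⟨i, -, hi⟩ := hz.eq_pow_of_pow_eq_one hζ.pow_eq_one
    conv_lhs => rw [← hi]
    exact norm_pow_sub_one_le (by rw [norm_pow, hn, one_pow]) i
  rw [Finset.prod_congr rfl hk, Finset.prod_const, Finset.card_range] at h'
  rw [h', ← Nat.cast_add_one, hp1]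

/-- (x - 1)^p and x^p - 1 differ by terms divisible by p, up to integral factors. -/
theorem norm_sub_one_lt_of_pow {x : L} (hx : ‖x‖ ≤ 1) (h : ‖x ^ p - 1‖ < 1) : ‖x - 1‖ < 1 := by
  have hy : ‖x - 1‖ ≤ 1 := by
    simpa [hx, sub_eq_add_neg] using IsUltrametricDist.norm_add_le_max x (-1)
  set y := x - 1 with hydef
  have hxy : x = y + 1 := by rw [hydef, sub_add_cancel]
  obtain ⟨q, hq⟩ : ∃ q, p = q + 1 := ⟨p - 1, (Nat.sub_add_cancel hp.out.one_lt.le).symm⟩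
  have key : y ^ p = (x ^ p - 1) - ∑ k ∈ Finset.range q, y ^ (k + 1) * (p.choose (k + 1) : L) := by
    rw [hxy, add_pow, Finset.sum_range_succ, hq, Finset.sum_range_succ']
    simp
    ring
  have hs : ‖∑ k ∈ Finset.range q, y ^ (k + 1) * (p.choose (k + 1) : L)‖ ≤ ‖(p : L)‖ := by
    refine IsUltrametricDist.norm_sum_le_of_forall_le_of_nonneg (norm_nonneg _) fun k hk => ?_
    rw [Finset.mem_range] at hk
    obtain ⟨t, ht⟩ := hp.out.dvd_choose_self (k := k + 1) (Nat.succ_ne_zero k) (by omega)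
    rw [ht, Nat.cast_mul, norm_mul, norm_mul, norm_pow]
    have h1 : ‖y‖ ^ (k + 1) ≤ 1 := pow_le_one₀ (norm_nonneg _) hy
    have h2 : ‖(t : L)‖ ≤ 1 := IsUltrametricDist.norm_natCast_le_one L t
    calc _ ≤ 1 * (‖(p : L)‖ * 1) := by gcongr
      _ = _ := by ring
  have hlt : ‖y ^ p‖ < 1 := by
    rw [key, sub_eq_add_neg]
    refine lt_of_le_of_lt (IsUltrametricDist.norm_add_le_max _ _) (max_lt h ?_)
    rw [norm_neg]
    exact hs.trans_lt (norm_prime_lt_one p)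
  rw [norm_pow] at hlt
  by_contra hge
  exact absurd hlt (not_lt.mpr (one_le_pow₀ (not_lt.mp hge)))

theorem norm_sub_one_lt_one {ζ : L} {e : ℕ} (hζ : IsPrimitiveRoot ζ (p ^ e)) :
    ‖ζ - 1‖ < 1 := by
  induction e generalizing ζ with
  | zero =>
    have : ζ = 1 := by simpa using hζ
    simp [this]
  | succ e ih =>
    have hn := norm_eq_one_of_isPrimitiveRoot (pow_ne_zero _ hp.out.ne_zero) hζ
    refine norm_sub_one_lt_of_pow (p := p) hn.le (ih (hζ.pow (pow_pos hp.out.pos _) ?_))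
    rw [pow_succ']

end RootsOfUnity
end

/-! ### Integrality of the Artin–Hasse exponential. -/

noncomputable section

open scoped Classical in
/-- The logarithm `∑ T ^ (p ^ k) / p ^ k` of the Artin–Hasse exponential. -/
def artinHasseLog (p : ℕ) (F : Type*) [Field F] : F⟦X⟧ :=
  PowerSeries.mk fun n => if ∃ k, n = p ^ k then (n : F)⁻¹ else 0

theorem coeff_artinHasseLog_pow (p : ℕ) (F : Type*) [Field F] (k : ℕ) :
    PowerSeries.coeff (p ^ k) (artinHasseLog p F) = ((p ^ k : ℕ) : F)⁻¹ := by
  rw [artinHasseLog, PowerSeries.coeff_mk, if_pos ⟨k, rfl⟩]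

theorem coeff_artinHasseLog_of_forall_ne (p : ℕ) (F : Type*) [Field F] {n : ℕ}
    (h : ∀ k, n ≠ p ^ k) : PowerSeries.coeff n (artinHasseLog p F) = 0 := by
  rw [artinHasseLog, PowerSeries.coeff_mk, if_neg (by simpa using h)]

section

variable (p : ℕ) [hp : Fact p.Prime]

theorem constantCoeff_artinHasseLog (F : Type*) [Field F] :
    PowerSeries.constantCoeff (artinHasseLog p F) = 0 := by
  rw [← PowerSeries.coeff_zero_eq_constantCoeff_apply]
  exact coeff_artinHasseLog_of_forall_ne p F fun k => (pow_pos hp.out.pos k).ne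

theorem nsmul_artinHasseLog (F : Type*) [Field F] [CharZero F] :
    p • artinHasseLog p F = (p : F) • PowerSeries.X +
      PowerSeries.expand p hp.out.ne_zero (artinHasseLog p F) := by
  have hp0 : (p : F) ≠ 0 := Nat.cast_ne_zero.mpr hp.out.ne_zero
  ext n
  rw [map_nsmul, map_add, PowerSeries.coeff_smul, PowerSeries.coeff_X, PowerSeries.coeff_expand,
    nsmul_eq_mul, smul_eq_mul]
  by_cases h : ∃ k, n = p ^ k
  · obtain ⟨k, rfl⟩ := h
    rw [coeff_artinHasseLog_pow]
    rcases k with _ | k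
    · have : ¬ p ∣ 1 := hp.out.one_lt.ne' ∘ Nat.dvd_one.mp
      simp [this]
    · have h1 : p ^ (k + 1) ≠ 1 := (Nat.one_lt_pow (Nat.succ_ne_zero k) hp.out.one_lt).ne'
      rw [if_neg h1, if_pos (dvd_pow_self p (Nat.succ_ne_zero k)), pow_succ,
        Nat.mul_div_cancel _ hp.out.pos, coeff_artinHasseLog_pow]
      push_cast
      field_simp
      simp
  · rw [not_exists] at h
    have h1 : n ≠ 1 := by simpa using h 0
    rw [coeff_artinHasseLog_of_forall_ne p F h, if_neg h1]
    split_ifs with hd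
    · rw [coeff_artinHasseLog_of_forall_ne]
      · simp
      · intro k hk
        refine h (k + 1) ?_
        rw [pow_succ, ← hk, Nat.div_mul_cancel hd]
    · simp

/-- Exponentiate p A(T) = p T + A(T^p). -/
theorem artinHasse_pow (F : Type*) [Field F] [CharZero F] :
    expComp (artinHasseLog p F) ^ p = PowerSeries.expand p hp.out.ne_zero
      (expComp (artinHasseLog p F)) * PowerSeries.rescale (p : F) (PowerSeries.exp F) := by
  have h0 := constantCoeff_artinHasseLog p F
  have h1 : PowerSeries.constantCoeff ((p : F) • (PowerSeries.X : F⟦X⟧)) = 0 := by simp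
  have h2 : PowerSeries.constantCoeff
      (PowerSeries.expand p hp.out.ne_zero (artinHasseLog p F)) = 0 := by
    rw [PowerSeries.constantCoeff_expand, h0]
  have h3 := expComp_expand_rescale h0 1 hp.out.ne_zero
  rw [PowerSeries.rescale_one] at h3
  rw [← expComp_nsmul h0, nsmul_artinHasseLog, expComp_add h1 h2, mul_comm]
  simp only [RingHom.id_apply] at h3
  rw [h3, PowerSeries.rescale_eq_subst, ← expComp]

theorem norm_coeff_pow_sub_expand_le (q : ℤ_[p][X]) (n : ℕ) :
    ‖(q ^ p - Polynomial.expand ℤ_[p] p q).coeff n‖ ≤ ‖(p : ℤ_[p])‖ := by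
  have h : (q ^ p - Polynomial.expand ℤ_[p] p q).map (PadicInt.toZMod (p := p)) = 0 := by
    rw [Polynomial.map_sub, Polynomial.map_pow, Polynomial.map_expand, ZMod.expand_card, sub_self]
  have h1 : (q ^ p - Polynomial.expand ℤ_[p] p q).coeff n ∈
      RingHom.ker (PadicInt.toZMod (p := p)) := by
    rw [RingHom.mem_ker, ← Polynomial.coeff_map, h, Polynomial.coeff_zero]
  rw [PadicInt.ker_toZMod, PadicInt.maximalIdeal_eq_span_p, Ideal.mem_span_singleton] at h1
  obtain ⟨t, ht⟩ := h1
  rw [ht, norm_mul]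
  exact mul_le_of_le_one_right (norm_nonneg _) (PadicInt.norm_le_one t)

theorem norm_pow_div_factorial_le {n : ℕ} (hn : n ≠ 0) :
    ‖(p : ℚ_[p]) ^ n / (n.factorial : ℚ_[p])‖ ≤ ‖(p : ℚ_[p])‖ := by
  have hpos := norm_prime_pos p (L := ℚ_[p])
  have hlt := sub_one_mul_padicValNat_factorial_lt_of_ne_zero p hn
  have h1 : padicValNat p n.factorial < n :=
    lt_of_le_of_lt (Nat.le_mul_of_pos_left _ (Nat.sub_pos_of_lt hp.out.one_lt)) hlt
  rw [norm_div, norm_factorial_eq p (L := ℚ_[p]), norm_pow, div_le_iff₀ (by positivity),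
    ← pow_succ']
  exact pow_le_pow_of_le_one hpos.le (norm_prime_lt_one p).le h1

/-- Dwork's argument, by induction on n: E^p = E(T^p) exp(pT) is compared modulo p with Q^p ≡
Q(T^p), where Q is the truncation of E below degree n. The nth coefficients of E^p and Q^p differ by
p E_n, so p E_n lies in p ℤ_p. -/
theorem norm_coeff_artinHasse_padic_le (n : ℕ) :
    ‖PowerSeries.coeff n (expComp (artinHasseLog p ℚ_[p]))‖ ≤ 1 := by
  set E := expComp (artinHasseLog p ℚ_[p]) with hE
  have hE0 : PowerSeries.constantCoeff E = 1 :=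
    constantCoeff_expComp (constantCoeff_artinHasseLog p _)
  induction n using Nat.strong_induction_on with
  | _ n ih =>
  rcases Nat.eq_zero_or_pos n with rfl | hn
  · simp [hE0]
  have hex : ∀ j, ∃ e : ℤ_[p], j < n → (e : ℚ_[p]) = PowerSeries.coeff j E := fun j => by
    by_cases hj : j < n
    · exact ⟨⟨_, ih j hj⟩, fun _ => rfl⟩
    · exact ⟨0, fun h => absurd h hj⟩
  choose e he using hex
  set q : ℤ_[p][X] := PowerSeries.trunc n (PowerSeries.mk e) with hq
  let φ : ℤ_[p] →+* ℚ_[p] := PadicInt.Coe.ringHom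
  have hφ : ∀ x, φ x = (x : ℚ_[p]) := fun _ => rfl
  set Q : ℚ_[p]⟦X⟧ := ((q.map φ : ℚ_[p][X]) : ℚ_[p]⟦X⟧) with hQ
  have hQc : ∀ j, PowerSeries.coeff j Q = if j < n then PowerSeries.coeff j E else 0 := by
    intro j
    rw [hQ, Polynomial.coeff_coe, Polynomial.coeff_map, hq, PowerSeries.coeff_trunc,
      PowerSeries.coeff_mk]
    split_ifs with h
    · rw [hφ, he j h]
    · simp
  have hQ0 : PowerSeries.constantCoeff Q = 1 := by
    rw [← PowerSeries.coeff_zero_eq_constantCoeff_apply, hQc, if_pos hn,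
      PowerSeries.coeff_zero_eq_constantCoeff_apply, hE0]
  -- comparison of `E ^ p` with `Q ^ p`
  have hA : PowerSeries.coeff n (E ^ p) =
      PowerSeries.coeff n (Q ^ p) + p * PowerSeries.coeff n E := by
    obtain ⟨u, hu⟩ : PowerSeries.X ^ n ∣ E - Q := by
      rw [PowerSeries.X_pow_dvd_iff]
      intro m hm
      rw [map_sub, hQc, if_pos hm, sub_self]
    have hu0 : PowerSeries.constantCoeff u = PowerSeries.coeff n E := by
      have := congrArg (PowerSeries.coeff n) hu
      rw [map_sub, hQc, if_neg (lt_irrefl n), sub_zero] at this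
      rw [this]
      simpa using (PowerSeries.coeff_X_pow_mul u n 0).symm
    have hg := (Commute.all E Q).mul_geom_sum₂ p
    rw [hu, mul_assoc] at hg
    have h2 := congrArg (PowerSeries.coeff n) hg
    rw [map_sub] at h2
    have h3 := PowerSeries.coeff_X_pow_mul
      (u * ∑ i ∈ Finset.range p, E ^ i * Q ^ (p - 1 - i)) n 0
    rw [zero_add] at h3
    rw [h3] at h2
    simp [hE0, hQ0, hu0] at h2
    linear_combination -h2
  -- Frobenius modulo p for Q; the coefficient of T^n in E(T^p) only involves index n/p < n, where Q
  -- and E agree.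
  have hB : ‖PowerSeries.coeff n (Q ^ p) -
      PowerSeries.coeff n (PowerSeries.expand p hp.out.ne_zero E)‖ ≤ ‖(p : ℚ_[p])‖ := by
    have h1 := norm_coeff_pow_sub_expand_le p q n
    have h2 : (((q ^ p - Polynomial.expand ℤ_[p] p q).coeff n : ℤ_[p]) : ℚ_[p]) =
        PowerSeries.coeff n (Q ^ p) -
          PowerSeries.coeff n (PowerSeries.expand p hp.out.ne_zero E) := by
      rw [← hφ, Polynomial.coeff_sub, map_sub, ← Polynomial.coeff_map, Polynomial.map_pow,
        ← Polynomial.coeff_coe, Polynomial.coe_pow, ← hQ, Polynomial.coeff_expand hp.out.pos,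
        PowerSeries.coeff_expand]
      congr 1
      split_ifs with hd
      · have hlt : n / p < n := Nat.div_lt_self hn hp.out.one_lt
        rw [← Polynomial.coeff_map, ← Polynomial.coeff_coe, ← hQ, hQc, if_pos hlt]
      · simp
    rw [← h2, PadicInt.padic_norm_e_of_padicInt]
    simpa using h1
  -- Here exp(pT) ≡ 1 modulo p, and the coefficients of E(T^p) that occur are integral by induction.
  have hC : ‖PowerSeries.coeff n (E ^ p) -
      PowerSeries.coeff n (PowerSeries.expand p hp.out.ne_zero E)‖ ≤ ‖(p : ℚ_[p])‖ := by
    rw [hE, artinHasse_pow, ← hE, ← map_sub]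
    have h1 : PowerSeries.expand p hp.out.ne_zero E *
        PowerSeries.rescale (p : ℚ_[p]) (PowerSeries.exp ℚ_[p]) -
        PowerSeries.expand p hp.out.ne_zero E = PowerSeries.expand p hp.out.ne_zero E *
        (PowerSeries.rescale (p : ℚ_[p]) (PowerSeries.exp ℚ_[p]) - 1) := by ring
    rw [h1, PowerSeries.coeff_mul]
    refine IsUltrametricDist.norm_sum_le_of_forall_le_of_nonneg (norm_nonneg _) ?_
    rintro ⟨a, b⟩ hab
    rw [Finset.HasAntidiagonal.mem_antidiagonal] at hab
    simp only at hab
    rw [norm_mul, map_sub, PowerSeries.coeff_rescale, PowerSeries.coeff_exp, PowerSeries.coeff_one]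
    rcases Nat.eq_zero_or_pos b with rfl | hb
    · simp
    rw [if_neg hb.ne', sub_zero]
    have h2 := norm_pow_div_factorial_le p hb.ne'
    have h3 : ‖PowerSeries.coeff a (PowerSeries.expand p hp.out.ne_zero E)‖ ≤ 1 := by
      rw [PowerSeries.coeff_expand]
      split_ifs with hd
      · exact ih _ (lt_of_le_of_lt (Nat.div_le_self a p) (by omega))
      · simp
    have h4 : (p : ℚ_[p]) ^ b * algebraMap ℚ ℚ_[p] (1 / (b.factorial : ℚ)) =
        (p : ℚ_[p]) ^ b / (b.factorial : ℚ_[p]) := by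
      simp [div_eq_mul_inv]
    rw [h4]
    exact (mul_le_of_le_one_left (norm_nonneg _) h3).trans h2
  have hD : (p : ℚ_[p]) * PowerSeries.coeff n E =
      (PowerSeries.coeff n (E ^ p) -
        PowerSeries.coeff n (PowerSeries.expand p hp.out.ne_zero E)) -
      (PowerSeries.coeff n (Q ^ p) -
        PowerSeries.coeff n (PowerSeries.expand p hp.out.ne_zero E)) := by
    rw [hA]; ring
  have hF : ‖(p : ℚ_[p])‖ * ‖PowerSeries.coeff n E‖ ≤ ‖(p : ℚ_[p])‖ := by
    rw [← norm_mul, hD, sub_eq_add_neg]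
    refine (IsUltrametricDist.norm_add_le_max _ _).trans (max_le hC ?_)
    rwa [norm_neg]
  have hpos := norm_prime_pos p (L := ℚ_[p])
  exact le_of_mul_le_mul_left (by rwa [mul_one]) hpos

variable {L : Type*} [NormedField L] [CharZero L] [NormedAlgebra ℚ_[p] L] [IsUltrametricDist L]

omit [IsUltrametricDist L] in
theorem gaussLE_artinHasse : GaussLE 1 1 (expComp (artinHasseLog p L)) := by
  have h : artinHasseLog p L = PowerSeries.map (algebraMap ℚ_[p] L) (artinHasseLog p ℚ_[p]) := by
    ext n
    rw [PowerSeries.coeff_map, artinHasseLog, artinHasseLog, PowerSeries.coeff_mk,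
      PowerSeries.coeff_mk]
    split_ifs <;> simp
  rw [gaussLE_one_left_iff, h, ← map_expComp _ (constantCoeff_artinHasseLog p _)]
  intro n
  rw [PowerSeries.coeff_map, norm_algebraMap']
  exact norm_coeff_artinHasse_padic_le p n

/-- The power series `A (c T ^ m)`, where `A` is the Artin–Hasse logarithm. -/
def artinHasseLogAt (p : ℕ) {F : Type*} [Field F] (c : F) (m : ℕ) : F⟦X⟧ :=
  if hm : m ≠ 0 then PowerSeries.expand m hm (PowerSeries.rescale c (artinHasseLog p F)) else 0

omit hp in
theorem coeff_artinHasseLogAt_mul {F : Type*} [Field F] (c : F) {m : ℕ} (hm : m ≠ 0) (k : ℕ) :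
    PowerSeries.coeff (m * p ^ k) (artinHasseLogAt p c m) = c ^ p ^ k / (p : F) ^ k := by
  rw [artinHasseLogAt, dif_pos hm, PowerSeries.coeff_expand, if_pos (dvd_mul_right _ _),
    Nat.mul_div_cancel_left _ (Nat.pos_of_ne_zero hm), PowerSeries.coeff_rescale,
    coeff_artinHasseLog_pow, Nat.cast_pow, div_eq_mul_inv]

omit hp in
theorem coeff_artinHasseLogAt_of_forall_ne {F : Type*} [Field F] (c : F) {m i : ℕ}
    (h : ∀ k, i ≠ m * p ^ k) : PowerSeries.coeff i (artinHasseLogAt p c m) = 0 := by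
  rw [artinHasseLogAt]
  split_ifs with hm
  · rw [PowerSeries.coeff_expand]
    split_ifs with hd
    · rw [PowerSeries.coeff_rescale, coeff_artinHasseLog_of_forall_ne, mul_zero]
      intro k hk
      exact h k (by rw [← hk, Nat.mul_div_cancel' hd])
    · rfl
  · simp

theorem constantCoeff_artinHasseLogAt {F : Type*} [Field F] (c : F) (m : ℕ) :
    PowerSeries.constantCoeff (artinHasseLogAt p c m) = 0 := by
  rw [artinHasseLogAt]
  split_ifs with hm
  · rw [PowerSeries.constantCoeff_expand, ← PowerSeries.coeff_zero_eq_constantCoeff_apply,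
      PowerSeries.coeff_rescale]
    simp [constantCoeff_artinHasseLog]
  · simp

omit [IsUltrametricDist L] in
theorem gaussLE_expComp_artinHasseLogAt {ρ : ℝ} (hρ : 0 ≤ ρ) {c : L} {m : ℕ}
    (hc : ‖c‖ * ρ ^ m ≤ 1) : GaussLE ρ 1 (expComp (artinHasseLogAt p c m)) := by
  rw [artinHasseLogAt]
  split_ifs with hm
  · rw [expComp_expand_rescale (constantCoeff_artinHasseLog p L)]
    exact (gaussLE_artinHasse p).expand_rescale hρ hm hc
  · rw [expComp_zero]
    exact gaussLE_one ρ

theorem gaussLE_expComp_neg_artinHasseLogAt {ρ : ℝ} (hρ : 0 < ρ) {c : L} {m : ℕ}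
    (hc : ‖c‖ * ρ ^ m ≤ 1) : GaussLE ρ 1 (expComp (-artinHasseLogAt p c m)) :=
  (gaussLE_expComp_artinHasseLogAt p hρ.le hc).of_mul_eq_one hρ
    (constantCoeff_expComp (constantCoeff_artinHasseLogAt p c m))
    (expComp_mul_expComp_neg (constantCoeff_artinHasseLogAt p c m))

end
end

/-! ### Exponentials exp(π g) with an exact radius. -/

noncomputable section

section

variable {p : ℕ} [hp : Fact p.Prime] {L : Type*} [NormedField L] [CharZero L]
  [NormedAlgebra ℚ_[p] L] [IsUltrametricDist L]

omit [CharZero L] [IsUltrametricDist L] in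
theorem norm_lt_one_of_pow_eq_prime {π : L} (hπ : ‖π‖ ^ (p - 1) = ‖(p : L)‖) : ‖π‖ < 1 := by
  by_contra h
  have h1 := one_le_pow₀ (not_lt.mp h) (n := p - 1)
  rw [hπ] at h1
  exact absurd (norm_prime_lt_one p (L := L)) (not_lt.mpr h1)

omit [CharZero L] [IsUltrametricDist L] in
theorem norm_pos_of_pow_eq_prime {π : L} (hπ : ‖π‖ ^ (p - 1) = ‖(p : L)‖) : 0 < ‖π‖ := by
  rcases (norm_nonneg π).eq_or_lt with h | h
  · rw [← h, zero_pow (Nat.sub_pos_of_lt hp.out.one_lt).ne'] at hπ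
    exact absurd hπ (norm_prime_pos p (L := L)).ne
  · exact h

/-- If `|π| ^ (p - 1) = |p|` and the exponents of `g` lie in `(N / p, N]`, where `N` is the degree
of `g`, then the coefficient of `exp(π g)` of degree `N p ^ k` is dominated by that of
`(π g) ^ (p ^ k) / (p ^ k)!`. -/
theorem norm_coeff_expComp_mul_pow_eq {π : L} (hπ : ‖π‖ ^ (p - 1) = ‖(p : L)‖) {r : ℝ} (hr : 0 < r)
    {g : L[X]} (hN : g.natDegree ≠ 0) (hg : GaussLE r 1 (g : L⟦X⟧))
    (hlead : ‖g.leadingCoeff‖ * r ^ g.natDegree = 1)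
    (hlow : ∀ i, g.coeff i ≠ 0 → g.natDegree < i * p) (k : ℕ) :
    ‖PowerSeries.coeff (g.natDegree * p ^ k)
      (expComp (((Polynomial.C π * g : L[X])) : L⟦X⟧))‖ * r ^ (g.natDegree * p ^ k) = ‖π‖ := by
  have hω0 : 0 < ‖π‖ := norm_pos_of_pow_eq_prime hπ
  have hω1 : ‖π‖ < 1 := norm_lt_one_of_pow_eq_prime hπ
  set N := g.natDegree with hNdef
  have hpk : 0 < p ^ k := pow_pos hp.out.pos k
  -- This makes g^n vanish to order beyond N p^k once n ≥ p^(k+1).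
  have hdvd : (Polynomial.X : L[X]) ^ (N / p + 1) ∣ g := by
    rw [Polynomial.X_pow_dvd_iff]
    intro i hi
    by_contra h
    have h1 := (Nat.div_lt_iff_lt_mul hp.out.pos).mpr (hlow i h)
    omega
  have hg0 : g.coeff 0 = 0 := by
    by_contra h
    have := hlow 0 h
    omega
  have h0 : PowerSeries.constantCoeff ((Polynomial.C π * g : L[X]) : L⟦X⟧) = 0 := by
    rw [← PowerSeries.coeff_zero_eq_constantCoeff_apply, Polynomial.coeff_coe,
      Polynomial.coeff_C_mul, hg0, mul_zero]
  set t : ℕ → L := fun n => π ^ n * (g ^ n).coeff (N * p ^ k) / (n.factorial : L) with ht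
  have hcoef : PowerSeries.coeff (N * p ^ k) (expComp ((Polynomial.C π * g : L[X]) : L⟦X⟧)) =
      ∑ n ∈ Finset.range (N * p ^ k + 1), t n := by
    rw [coeff_expComp h0]
    refine Finset.sum_congr rfl fun n _ => ?_
    rw [← Polynomial.coe_pow, Polynomial.coeff_coe, mul_pow, ← Polynomial.C_pow,
      Polynomial.coeff_C_mul]
  have hmem : p ^ k ∈ Finset.range (N * p ^ k + 1) := by
    rw [Finset.mem_range, Nat.lt_succ_iff]
    exact Nat.le_mul_of_pos_left _ (Nat.pos_of_ne_zero hN)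
  have hmain : ‖t (p ^ k)‖ * r ^ (N * p ^ k) = ‖π‖ := by
    have h1 : (g ^ p ^ k).coeff (N * p ^ k) = g.leadingCoeff ^ p ^ k := by
      rw [mul_comm, hNdef, Polynomial.coeff_pow_mul_natDegree]
    rw [ht]
    simp only
    rw [h1, norm_div, norm_mul, norm_pow, norm_pow, pow_mul]
    calc _ = (‖π‖ ^ p ^ k / ‖((p ^ k).factorial : L)‖) *
          (‖g.leadingCoeff‖ * r ^ N) ^ p ^ k := by rw [mul_pow]; ring
      _ = ‖π‖ := by rw [hlead, one_pow, mul_one, pow_prime_pow_div_norm_factorial hω0 hπ]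
  -- For n < p^k the degree of g^n is too small, for n ≥ p^(k+1) its order is too large; in between,
  -- n ≠ p^k is not a power of p, so its digit sum is at least 2.
  have hrest : ∀ n ∈ (Finset.range (N * p ^ k + 1)).erase (p ^ k),
      ‖t n‖ ≤ ‖π‖ ^ 2 / r ^ (N * p ^ k) := by
    intro n hn
    rw [Finset.mem_erase, Finset.mem_range] at hn
    rw [le_div_iff₀ (pow_pos hr _)]
    by_cases hlt : n < p ^ k
    · have : (g ^ n).coeff (N * p ^ k) = 0 := by
        refine Polynomial.coeff_eq_zero_of_natDegree_lt
          (lt_of_le_of_lt Polynomial.natDegree_pow_le ?_)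
        rw [mul_comm]
        exact Nat.mul_lt_mul_of_pos_left hlt (Nat.pos_of_ne_zero hN)
      simp [ht, this]
    by_cases hge : p ^ (k + 1) ≤ n
    · have : (g ^ n).coeff (N * p ^ k) = 0 := by
        have hd := pow_dvd_pow_of_dvd hdvd n
        rw [← pow_mul, Polynomial.X_pow_dvd_iff] at hd
        refine hd _ ?_
        calc N * p ^ k < ((N / p + 1) * p) * p ^ k := by
              refine Nat.mul_lt_mul_of_pos_right ?_ hpk
              have := Nat.div_add_mod N p
              have := Nat.mod_lt N hp.out.pos
              nlinarith
          _ = (N / p + 1) * p ^ (k + 1) := by ring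
          _ ≤ _ := Nat.mul_le_mul_left _ hge
      simp [ht, this]
    have hs : 2 ≤ (p.digits n).sum := by
      refine two_le_digits_sum p (by omega) fun j hj => ?_
      have h1 : k < j + 1 := by
        by_contra h
        exact absurd (Nat.pow_lt_pow_right hp.out.one_lt (show j < k by omega)) (by omega)
      have h2 : j < k + 1 := by
        by_contra h
        exact absurd (Nat.pow_le_pow_right hp.out.pos (show k + 1 ≤ j by omega)) (by omega)
      have : j = k := by omega
      subst this
      omega
    have hgn := hg.pow hr zero_le_one n (N * p ^ k)
    rw [one_pow, ← Polynomial.coe_pow, Polynomial.coeff_coe] at hgn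
    rw [ht]
    simp only
    rw [norm_div, norm_mul, norm_pow]
    calc _ = (‖π‖ ^ n / ‖(n.factorial : L)‖) * (‖(g ^ n).coeff (N * p ^ k)‖ * r ^ (N * p ^ k)) := by
          ring
      _ ≤ ‖π‖ ^ (p.digits n).sum * 1 := by
          rw [pow_div_norm_factorial hω0 hπ]
          gcongr
      _ ≤ ‖π‖ ^ 2 := by
          rw [mul_one]
          exact pow_le_pow_of_le_one hω0.le hω1.le hs
  have hR : ‖∑ n ∈ (Finset.range (N * p ^ k + 1)).erase (p ^ k), t n‖ < ‖t (p ^ k)‖ := by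
    have h1 := IsUltrametricDist.norm_sum_le_of_forall_le_of_nonneg
      (C := ‖π‖ ^ 2 / r ^ (N * p ^ k)) (by positivity) hrest
    refine h1.trans_lt ?_
    rw [div_lt_iff₀ (pow_pos hr _), hmain, pow_two]
    exact mul_lt_of_lt_one_left hω0 hω1
  rw [hcoef, ← Finset.add_sum_erase _ _ hmem,
    IsUltrametricDist.norm_add_eq_max_of_norm_ne_norm hR.ne', max_eq_left hR.le, hmain]

/-- A series bounded at a radius `ρ > r` has coefficients of weight tending to `0` at `r`. -/
theorem GaussLE.tendsto {L : Type*} [NormedField L] {f : L⟦X⟧} {ρ c r : ℝ} (hf : GaussLE ρ c f)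
    (hr : 0 < r) (hrρ : r < ρ) :
    Filter.Tendsto (fun n => ‖PowerSeries.coeff n f‖ * r ^ n) Filter.atTop (nhds 0) := by
  have hρ : 0 < ρ := hr.trans hrρ
  have h1 : Filter.Tendsto (fun n : ℕ => c * (r / ρ) ^ n) Filter.atTop (nhds 0) := by
    simpa using (tendsto_pow_atTop_nhds_zero_of_lt_one (by positivity)
      ((div_lt_one hρ).mpr hrρ)).const_mul c
  refine squeeze_zero (fun n => by positivity) (fun n => ?_) h1
  calc _ = (‖PowerSeries.coeff n f‖ * ρ ^ n) * (r / ρ) ^ n := by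
        rw [div_pow]; field_simp
    _ ≤ _ := by gcongr; exact hf n

/-- A bound beyond r would force the weights at r to tend to 0, but along the degrees N p^k they are
constantly |π|. -/
theorem not_gaussLE_expComp_of_lt {π : L} (hπ : ‖π‖ ^ (p - 1) = ‖(p : L)‖) {r : ℝ} (hr : 0 < r)
    {g : L[X]} (hN : g.natDegree ≠ 0) (hg : GaussLE r 1 (g : L⟦X⟧))
    (hlead : ‖g.leadingCoeff‖ * r ^ g.natDegree = 1)
    (hlow : ∀ i, g.coeff i ≠ 0 → g.natDegree < i * p) {ρ c : ℝ} (hrρ : r < ρ) :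
    ¬ GaussLE ρ c (expComp (((Polynomial.C π * g : L[X])) : L⟦X⟧)) := by
  intro h
  have h1 := (h.tendsto hr hrρ).comp (f := fun k => g.natDegree * p ^ k)
    ((Filter.tendsto_id.const_mul_atTop' (Nat.pos_of_ne_zero hN)).comp
      (tendsto_pow_atTop_atTop_of_one_lt hp.out.one_lt))
  have h2 : (fun n => ‖PowerSeries.coeff n (expComp (((Polynomial.C π * g : L[X])) : L⟦X⟧))‖ * r ^ n)
      ∘ (fun k => g.natDegree * p ^ k) = fun _ => ‖π‖ :=
    funext fun k => norm_coeff_expComp_mul_pow_eq hπ hr hN hg hlead hlow k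
  rw [h2] at h1
  exact (norm_pos_of_pow_eq_prime hπ).ne (tendsto_nhds_unique h1 tendsto_const_nhds)

end
end

noncomputable section

/-! ### The lengths d_m and the compatible roots of unity. -/

section WittLen

theorem wittLen_mul_pow_add {p D m k : ℕ} (hp : 1 < p) (hm : 1 ≤ m) (h : m * p ^ k ≤ D) :
    wittLen p D (m * p ^ k) + k = wittLen p D m := by
  have hpk : 0 < p ^ k := pow_pos (by omega) k
  have hmk : 1 ≤ m * p ^ k := Nat.mul_pos hm hpk
  have hmD : m ≤ D := (Nat.le_mul_of_pos_right m hpk).trans h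
  have hk := (le_wittLen_iff hp hm hmD).mpr h
  refine le_antisymm ?_ ?_
  · rw [le_wittLen_iff hp hm hmD, add_comm, pow_add, ← mul_assoc, ← le_wittLen_iff hp hmk h]
  · rw [← Nat.sub_le_iff_le_add, le_wittLen_iff hp hmk h, mul_assoc, ← pow_add,
      Nat.add_sub_cancel' hk, ← le_wittLen_iff hp hm hmD]

theorem wittLen_le_wittLen_one {p D m : ℕ} (hp : 1 < p) (hm : 1 ≤ m) (h : m ≤ D) :
    wittLen p D m ≤ wittLen p D 1 := by
  rw [le_wittLen_iff hp le_rfl (hm.trans h)]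
  exact (Nat.mul_le_mul_right _ hm).trans ((le_wittLen_iff hp hm h).mp le_rfl)

variable {F : Type*} [Field F] {p D : ℕ} {ζ : F}

theorem zetaAt_wittLen_pow {m k : ℕ} (hp : 1 < p) (hm : 1 ≤ m) (h : m * p ^ k ≤ D) :
    zetaAt p D ζ (wittLen p D m) ^ p ^ k = zetaAt p D ζ (wittLen p D (m * p ^ k)) := by
  have h1 := wittLen_mul_pow_add hp hm h
  have hmD : m ≤ D := (Nat.le_mul_of_pos_right m (pow_pos (by omega) k)).trans h
  have h2 := wittLen_le_wittLen_one hp hm hmD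
  rw [zetaAt, zetaAt, ← pow_mul, ← pow_add]
  congr 2
  omega

theorem zetaAt_wittLen_pow_eq_one {m k : ℕ} (hp : 1 < p)
    (hζ : IsPrimitiveRoot ζ (p ^ (wittLen p D 1 + 1))) (hm : 1 ≤ m) (hmD : m ≤ D)
    (h : D < m * p ^ k) : zetaAt p D ζ (wittLen p D m) ^ p ^ k = 1 := by
  have h1 := zetaAt_isPrimitiveRoot (by omega) hζ (wittLen_le_wittLen_one hp hm hmD)
  rw [h1.pow_eq_one_iff_dvd]
  refine pow_dvd_pow _ ?_
  by_contra hk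
  exact absurd ((le_wittLen_iff hp hm hmD).mp (show k ≤ wittLen p D m by omega)) (by omega)

theorem zetaAt_sub_one_ne_zero {e : ℕ} (hp : 1 < p)
    (hζ : IsPrimitiveRoot ζ (p ^ (wittLen p D 1 + 1))) (he : e ≤ wittLen p D 1) :
    zetaAt p D ζ e - 1 ≠ 0 :=
  sub_ne_zero.mpr <| (zetaAt_isPrimitiveRoot (by omega) hζ he).ne_one
    (Nat.one_lt_pow (Nat.succ_ne_zero e) hp)

end WittLen

/-! ### Artin–Hasse coordinates and integrality. -/

section Coordinates

/-- The Artin–Hasse coordinates of a sequence `b`: the sequence `x` with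
`∑ b_i T ^ i = ∑ A (x_m T ^ m)`, where `A` is the Artin–Hasse logarithm. -/
def artinHasseCoord (p : ℕ) {F : Type*} [Field F] (b : ℕ → F) : ℕ → F
  | i => b i - ∑ j : Fin i, PowerSeries.coeff i (artinHasseLogAt p (artinHasseCoord p b j) j)
termination_by i => i
decreasing_by exact j.2

variable {p : ℕ} [hp : Fact p.Prime] {F : Type*} [Field F]

omit hp in
theorem coeff_self_artinHasseLogAt (c : F) {m : ℕ} (hm : m ≠ 0) :
    PowerSeries.coeff m (artinHasseLogAt p c m) = c := by
  simpa using coeff_artinHasseLogAt_mul p c hm 0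

theorem coeff_artinHasseLogAt_of_lt (c : F) {i m : ℕ} (h : i < m) :
    PowerSeries.coeff i (artinHasseLogAt p c m) = 0 := by
  refine coeff_artinHasseLogAt_of_forall_ne p c fun k hk => ?_
  have := Nat.le_mul_of_pos_right m (pow_pos hp.out.pos k)
  omega

theorem coeff_sum_artinHasseCoord (b : ℕ → F) {i D : ℕ} (hi : 1 ≤ i) (hiD : i ≤ D) :
    PowerSeries.coeff i (∑ m ∈ Finset.Icc 1 D, artinHasseLogAt p (artinHasseCoord p b m) m) =
      b i := by
  -- The system is triangular: terms with m > i start beyond degree i. The term m = 0 that appears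
  -- in the recursion is zero by convention.
  have h1 : ∑ m ∈ Finset.Icc 1 D,
      PowerSeries.coeff i (artinHasseLogAt p (artinHasseCoord p b m) m) =
      ∑ m ∈ Finset.range (i + 1),
        PowerSeries.coeff i (artinHasseLogAt p (artinHasseCoord p b m) m) := by
    refine Finset.sum_congr_of_eq_on_inter ?_ ?_ fun _ _ _ => rfl
    · intro m _ hm
      rw [Finset.mem_range, not_lt] at hm
      exact coeff_artinHasseLogAt_of_lt _ (by omega)
    · intro m hm hm'
      rw [Finset.mem_range] at hm
      rw [Finset.mem_Icc] at hm'
      have : m = 0 := by omega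
      simp [artinHasseLogAt, this]
  rw [map_sum, h1, Finset.sum_range_succ, coeff_self_artinHasseLogAt _ (by omega : i ≠ 0),
    artinHasseCoord, Finset.sum_range]
  ring

end Coordinates

section Integrality

variable {p : ℕ} [hp : Fact p.Prime] {L : Type*} [NormedField L] [CharZero L]
  [NormedAlgebra ℚ_[p] L] [IsUltrametricDist L]

/-- For the direct implication, induct on m: dividing exp(g) by the factors E(x_j T^j) with j < m,
integral by induction, leaves a series 1 + x_m T^m + ⋯. The converse is integrality of E. -/
theorem norm_coeff_expComp_le_iff {g : L⟦X⟧} (hg0 : PowerSeries.constantCoeff g = 0) {D : ℕ}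
    {x : ℕ → L} (hx : ∀ i ≤ D, PowerSeries.coeff i g =
      PowerSeries.coeff i (∑ m ∈ Finset.Icc 1 D, artinHasseLogAt p (x m) m)) :
    (∀ m ≤ D, ‖PowerSeries.coeff m (expComp g)‖ ≤ 1) ↔ ∀ m ∈ Finset.Icc 1 D, ‖x m‖ ≤ 1 := by
  constructor
  · intro h m
    induction m using Nat.strong_induction_on with
    | _ m ih =>
    intro hm
    rw [Finset.mem_Icc] at hm
    set S : L⟦X⟧ := ∑ j ∈ Finset.Ico 1 m, -artinHasseLogAt p (x j) j with hS
    have hS0 : PowerSeries.constantCoeff S = 0 :=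
      constantCoeff_finset_sum _ fun j _ => by simp [constantCoeff_artinHasseLogAt]
    have hSb : GaussLE 1 1 (expComp S) := by
      rw [hS, expComp_sum _ fun j _ => by simp [constantCoeff_artinHasseLogAt]]
      refine GaussLE.prod one_pos _ fun j hj => ?_
      rw [Finset.mem_Ico] at hj
      refine gaussLE_expComp_neg_artinHasseLogAt p one_pos ?_
      simpa using ih j hj.2 (Finset.mem_Icc.mpr ⟨hj.1, by omega⟩)
    have hcoef : ∀ i ≤ m, PowerSeries.coeff i (g + S) =
        PowerSeries.coeff i (artinHasseLogAt p (x m) m) := by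
      intro i hi
      have hsplit : Finset.Icc 1 D = Finset.Ico 1 m ∪ Finset.Icc m D := by
        ext j; simp only [Finset.mem_union, Finset.mem_Icc, Finset.mem_Ico]; omega
      have hdisj : Disjoint (Finset.Ico 1 m) (Finset.Icc m D) := by
        rw [Finset.disjoint_left]; intro j; simp only [Finset.mem_Icc, Finset.mem_Ico]; omega
      rw [map_add, hx i (by omega), hsplit, Finset.sum_union hdisj, hS, Finset.sum_neg_distrib,
        map_add, map_neg, add_comm, ← add_assoc, neg_add_cancel, zero_add, map_sum,
        Finset.sum_eq_single m]
      · intro j hj hjm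
        rw [Finset.mem_Icc] at hj
        exact coeff_artinHasseLogAt_of_lt _ (by omega)
      · intro hn
        exact absurd (Finset.mem_Icc.mpr ⟨le_rfl, hm.2⟩) hn
    have hxm : PowerSeries.coeff m (expComp (g + S)) = x m := by
      rw [coeff_expComp_of_coeff_eq_zero (m := m) hm.1 ?_ hm.1 le_rfl, hcoef m le_rfl,
        coeff_self_artinHasseLogAt _ (by omega)]
      intro i hi
      rw [hcoef i hi.le, coeff_artinHasseLogAt_of_lt _ hi]
    rw [← hxm, expComp_add hg0 hS0, PowerSeries.coeff_mul]
    refine IsUltrametricDist.norm_sum_le_of_forall_le_of_nonneg zero_le_one ?_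
    rintro ⟨a, b⟩ hab
    rw [Finset.HasAntidiagonal.mem_antidiagonal] at hab
    simp only at hab
    rw [norm_mul]
    exact mul_le_one₀ (h a (by omega)) (norm_nonneg _) (gaussLE_one_left_iff.mp hSb b)
  · intro h m hm
    rw [coeff_expComp_congr hg0 hx hm,
      expComp_sum _ fun j _ => constantCoeff_artinHasseLogAt p (x j) j]
    refine gaussLE_one_left_iff.mp (GaussLE.prod one_pos _ fun j hj => ?_) m
    exact gaussLE_expComp_artinHasseLogAt p zero_le_one (by simpa using h j hj)

end Integrality

/-! ### Pulita exponentials and the exact decomposition of P. -/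

section Pulita

/-- The logarithm of the Pulita exponential `E (ζ_{d_m} x T ^ m) / E (x T ^ m)`. -/
def pulitaLog (p D : ℕ) {F : Type*} [Field F] (ζ x : F) (m : ℕ) : F⟦X⟧ :=
  artinHasseLogAt p (zetaAt p D ζ (wittLen p D m) * x) m - artinHasseLogAt p x m

variable {p D : ℕ} [hp : Fact p.Prime]

theorem constantCoeff_pulitaLog {F : Type*} [Field F] (ζ x : F) (m : ℕ) :
    PowerSeries.constantCoeff (pulitaLog p D ζ x m) = 0 := by
  simp [pulitaLog, constantCoeff_artinHasseLogAt]

theorem coeff_pulitaLog_of_le {F : Type*} [Field F] (ζ x : F) {m i : ℕ} (hm : 1 ≤ m)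
    (hi : i ≤ D) : PowerSeries.coeff i (pulitaLog p D ζ x m) =
      (zetaAt p D ζ (wittLen p D i) - 1) * PowerSeries.coeff i (artinHasseLogAt p x m) := by
  rw [pulitaLog, map_sub]
  by_cases h : ∃ k, i = m * p ^ k
  · obtain ⟨k, rfl⟩ := h
    rw [coeff_artinHasseLogAt_mul p _ (by omega), coeff_artinHasseLogAt_mul p _ (by omega),
      mul_pow, zetaAt_wittLen_pow hp.out.one_lt hm hi]
    ring
  · rw [not_exists] at h
    rw [coeff_artinHasseLogAt_of_forall_ne p _ h, coeff_artinHasseLogAt_of_forall_ne p _ h]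
    simp

theorem coeff_pulitaLog_of_lt {F : Type*} [Field F] {ζ : F}
    (hζ : IsPrimitiveRoot ζ (p ^ (wittLen p D 1 + 1))) (x : F) {m i : ℕ} (hm : 1 ≤ m)
    (hmD : m ≤ D) (hi : D < i) : PowerSeries.coeff i (pulitaLog p D ζ x m) = 0 := by
  rw [pulitaLog, map_sub]
  by_cases h : ∃ k, i = m * p ^ k
  · obtain ⟨k, rfl⟩ := h
    rw [coeff_artinHasseLogAt_mul p _ (by omega), coeff_artinHasseLogAt_mul p _ (by omega),
      mul_pow, zetaAt_wittLen_pow_eq_one hp.out.one_lt hζ hm hmD hi]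
    ring
  · rw [not_exists] at h
    rw [coeff_artinHasseLogAt_of_forall_ne p _ h, coeff_artinHasseLogAt_of_forall_ne p _ h]
    simp

theorem eq_sum_pulitaLog {F : Type*} [Field F] {ζ : F}
    (hζ : IsPrimitiveRoot ζ (p ^ (wittLen p D 1 + 1))) {f : F⟦X⟧}
    (hf0 : PowerSeries.constantCoeff f = 0) (hfD : ∀ i, D < i → PowerSeries.coeff i f = 0) :
    f = ∑ m ∈ Finset.Icc 1 D, pulitaLog p D ζ (artinHasseCoord p
      (fun i => PowerSeries.coeff i f / (zetaAt p D ζ (wittLen p D i) - 1)) m) m := by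
  ext i
  rw [map_sum]
  by_cases hi : D < i
  · rw [hfD i hi, Finset.sum_eq_zero]
    intro m hm
    rw [Finset.mem_Icc] at hm
    exact coeff_pulitaLog_of_lt hζ _ hm.1 hm.2 hi
  rw [not_lt] at hi
  rcases Nat.eq_zero_or_pos i with rfl | hi0
  · rw [PowerSeries.coeff_zero_eq_constantCoeff_apply, hf0, Finset.sum_eq_zero]
    intro m _
    rw [PowerSeries.coeff_zero_eq_constantCoeff_apply, constantCoeff_pulitaLog]
  rw [Finset.sum_congr rfl fun m hm => coeff_pulitaLog_of_le ζ _ (Finset.mem_Icc.mp hm).1 hi,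
    ← Finset.mul_sum, ← map_sum, coeff_sum_artinHasseCoord _ hi0 hi,
    mul_div_cancel₀ _ (zetaAt_sub_one_ne_zero hp.out.one_lt hζ
      (wittLen_le_wittLen_one hp.out.one_lt hi0 hi))]

variable {L : Type*} [NormedField L] [CharZero L] [NormedAlgebra ℚ_[p] L] [IsUltrametricDist L]

theorem norm_zetaAt_eq_one {L : Type*} [NormedField L] {ζ : L}
    (hζ : IsPrimitiveRoot ζ (p ^ (wittLen p D 1 + 1))) (e : ℕ) : ‖zetaAt p D ζ e‖ = 1 := by
  rw [zetaAt, norm_pow,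
    norm_eq_one_of_isPrimitiveRoot (pow_ne_zero _ hp.out.ne_zero) hζ, one_pow]

theorem gaussLE_expComp_pulitaLog {ζ : L} (hζ : IsPrimitiveRoot ζ (p ^ (wittLen p D 1 + 1)))
    {ρ : ℝ} (hρ : 0 < ρ) {x : L} {m : ℕ} (hx : ‖x‖ * ρ ^ m ≤ 1) :
    GaussLE ρ 1 (expComp (pulitaLog p D ζ x m)) := by
  rw [pulitaLog, sub_eq_add_neg, expComp_add (constantCoeff_artinHasseLogAt p _ _)
    (by simp [constantCoeff_artinHasseLogAt]), ← mul_one (1 : ℝ)]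
  refine GaussLE.mul hρ zero_le_one zero_le_one (gaussLE_expComp_artinHasseLogAt p hρ.le ?_)
    (gaussLE_expComp_neg_artinHasseLogAt p hρ hx)
  rwa [norm_mul, norm_zetaAt_eq_one hζ, one_mul]

theorem gaussLE_expComp_neg_pulitaLog {ζ : L} (hζ : IsPrimitiveRoot ζ (p ^ (wittLen p D 1 + 1)))
    {ρ : ℝ} (hρ : 0 < ρ) {x : L} {m : ℕ} (hx : ‖x‖ * ρ ^ m ≤ 1) :
    GaussLE ρ 1 (expComp (-pulitaLog p D ζ x m)) :=
  (gaussLE_expComp_pulitaLog hζ hρ hx).of_mul_eq_one hρ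
    (constantCoeff_expComp (constantCoeff_pulitaLog ζ x m))
    (expComp_mul_expComp_neg (constantCoeff_pulitaLog ζ x m))

end Pulita
end

/-! ### Convergence in the open disc forces integral coordinates. -/

noncomputable section

section Converse

variable {p D : ℕ} [hp : Fact p.Prime]
variable {L : Type*} [NormedField L] [CharZero L] [NormedAlgebra ℚ_[p] L] [IsUltrametricDist L]

/-- The dominant term of `p ^ e` times `pulitaLog`, for `e = d_m`. -/
def pulitaLead (p D : ℕ) {F : Type*} [Field F] (ζ x : F) (e m : ℕ) : F[X] :=
  if wittLen p D m = e then
    Polynomial.monomial (m * p ^ e) ((zetaAt p D ζ 0 - 1) * x ^ p ^ e) else 0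

theorem coeff_pulitaLead_mul_pow {F : Type*} [Field F] (ζ x : F) (e : ℕ) {m : ℕ} (hm : m ≠ 0)
    (k : ℕ) : (pulitaLead p D ζ x e m).coeff (m * p ^ k) =
      if wittLen p D m = e ∧ k = e then (zetaAt p D ζ 0 - 1) * x ^ p ^ e else 0 := by
  have hinj : m * p ^ e = m * p ^ k ↔ k = e := by
    rw [Nat.mul_right_inj hm, Nat.pow_right_inj hp.out.one_lt]
    exact eq_comm
  rw [pulitaLead]
  by_cases h : wittLen p D m = e
  · simp [h, Polynomial.coeff_monomial, hinj]
  · simp [h]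

omit hp in
theorem coeff_pulitaLead_of_forall_ne {F : Type*} [Field F] (ζ x : F) (e : ℕ) {m i : ℕ}
    (h : ∀ k, i ≠ m * p ^ k) : (pulitaLead p D ζ x e m).coeff i = 0 := by
  rw [pulitaLead]
  split_ifs
  · rw [Polynomial.coeff_monomial, if_neg (h e).symm]
  · simp

theorem coeff_pulitaLead_of_lt {F : Type*} [Field F] (ζ x : F) (e : ℕ) {m i : ℕ} (hm : 1 ≤ m)
    (hmD : m ≤ D) (hi : D < i) : (pulitaLead p D ζ x e m).coeff i = 0 := by
  rw [pulitaLead]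
  split_ifs with h
  · rw [Polynomial.coeff_monomial, if_neg]
    have := (le_wittLen_iff hp.out.one_lt hm hmD).mp h.ge
    omega
  · simp

/-- In degree m p^k with k < e a factor p^(e-k) survives, of norm at most |p| ≤ |π|; strictness,
needed when p = 2, comes from |ζ_j - 1| < 1. For k = e the root of unity is ζ_0 and the leading term
cancels exactly. -/
theorem norm_coeff_nsmul_pulitaLog_sub_lt {ζ : L}
    (hζ : IsPrimitiveRoot ζ (p ^ (wittLen p D 1 + 1))) {r : ℝ} {x : L} {m e : ℕ}
    (hm : 1 ≤ m) (hmD : m ≤ D) (hx : ‖x‖ * r ^ m = 1) (he : wittLen p D m ≤ e) (i : ℕ) :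
    ‖PowerSeries.coeff i (p ^ e • pulitaLog p D ζ x m - (pulitaLead p D ζ x e m : L⟦X⟧))‖ * r ^ i <
      ‖zetaAt p D ζ 0 - 1‖ := by
  have hp1 := hp.out.one_lt
  have hζ0 := zetaAt_isPrimitiveRoot hp.out.pos hζ (Nat.zero_le _)
  rw [zero_add, pow_one] at hζ0
  have hπ := norm_sub_one_pow_eq hζ0
  have hω0 := norm_pos_of_pow_eq_prime hπ
  have hω1 := norm_lt_one_of_pow_eq_prime hπ
  rw [map_sub, map_nsmul, Polynomial.coeff_coe]
  by_cases hi : D < i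
  · rw [coeff_pulitaLog_of_lt hζ x hm hmD hi, coeff_pulitaLead_of_lt ζ x e hm hmD hi]
    simpa using hω0
  rw [not_lt] at hi
  by_cases h : ∃ k, i = m * p ^ k
  swap
  · rw [not_exists] at h
    rw [coeff_pulitaLog_of_le ζ x hm hi, coeff_artinHasseLogAt_of_forall_ne p x h,
      coeff_pulitaLead_of_forall_ne ζ x e h]
    simpa using hω0
  obtain ⟨k, rfl⟩ := h
  have hp0 : (p : L) ≠ 0 := Nat.cast_ne_zero.mpr hp.out.ne_zero
  have hadd := wittLen_mul_pow_add hp1 hm hi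
  rw [coeff_pulitaLog_of_le ζ x hm hi, coeff_artinHasseLogAt_mul p x (by omega),
    coeff_pulitaLead_mul_pow ζ x e (by omega) k, nsmul_eq_mul, Nat.cast_pow]
  by_cases hk : k = e
  · have h1 : wittLen p D m = e := by omega
    have h2 : wittLen p D (m * p ^ k) = 0 := by omega
    rw [if_pos ⟨h1, hk⟩, h2, hk]
    field_simp
    simpa using hω0
  · have hke : k < e := by omega
    rw [if_neg fun h => hk h.2, sub_zero]
    obtain ⟨t, rfl⟩ : ∃ t, e = k + (t + 1) := ⟨e - k - 1, by omega⟩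
    have h3 : (p : L) ^ (k + (t + 1)) * ((zetaAt p D ζ (wittLen p D (m * p ^ k)) - 1) *
        (x ^ p ^ k / (p : L) ^ k)) = (p : L) ^ (t + 1) *
          (zetaAt p D ζ (wittLen p D (m * p ^ k)) - 1) * x ^ p ^ k := by
      rw [pow_add]; field_simp
    rw [h3, norm_mul, norm_mul, norm_pow, norm_pow, mul_assoc, pow_mul, ← mul_pow, hx, one_pow,
      mul_one]
    have h4 : ‖zetaAt p D ζ (wittLen p D (m * p ^ k)) - 1‖ < 1 :=
      norm_sub_one_lt_one (zetaAt_isPrimitiveRoot hp.out.pos hζ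
        (wittLen_le_wittLen_one hp1 (Nat.mul_pos hm (pow_pos hp.out.pos k)) hi))
    have hppos := norm_prime_pos p (L := L)
    calc _ < ‖(p : L)‖ ^ (t + 1) * 1 := by gcongr
      _ ≤ ‖(p : L)‖ := by
        rw [mul_one]
        exact pow_le_of_le_one hppos.le (norm_prime_lt_one p).le (Nat.succ_ne_zero t)
      _ ≤ _ := by
        rw [← hπ]
        exact pow_le_of_le_one hω0.le hω1.le (Nat.sub_pos_of_lt hp1).ne'

/-- The product of the dominant terms of the factors of maximal length is not overconvergent. -/
theorem not_gaussLE_expComp_sum_pulitaLead {ζ : L}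
    (hζ : IsPrimitiveRoot ζ (p ^ (wittLen p D 1 + 1))) {r : ℝ} (hr : 0 < r) {x : ℕ → L}
    {U : Finset ℕ} (hU : U ⊆ Finset.Icc 1 D) (hx : ∀ m ∈ U, ‖x m‖ * r ^ m = 1) {e : ℕ}
    (he : ∃ m ∈ U, wittLen p D m = e) {ρ c : ℝ} (hrρ : r < ρ) :
    ¬ GaussLE ρ c (expComp ((∑ m ∈ U, pulitaLead p D ζ (x m) e m : L[X]) : L⟦X⟧)) := by
  have hp1 := hp.out.one_lt
  have hpe : 0 < p ^ e := pow_pos hp.out.pos e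
  have hζ0 := zetaAt_isPrimitiveRoot hp.out.pos hζ (Nat.zero_le _)
  rw [zero_add, pow_one] at hζ0
  have hπ := norm_sub_one_pow_eq hζ0
  set V := U.filter fun m => wittLen p D m = e with hV
  set g : L[X] := ∑ m ∈ V, Polynomial.monomial (m * p ^ e) (x m ^ p ^ e) with hg
  have hsum : ∑ m ∈ U, pulitaLead p D ζ (x m) e m =
      Polynomial.C (zetaAt p D ζ 0 - 1) * g := by
    rw [hg, Finset.mul_sum, hV, Finset.sum_filter]
    refine Finset.sum_congr rfl fun m _ => ?_
    rw [pulitaLead]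
    split_ifs
    · rw [Polynomial.C_mul_monomial]
    · rfl
  have hVI : ∀ m ∈ V, m ∈ U ∧ 1 ≤ m ∧ m ≤ D ∧ wittLen p D m = e := by
    intro m hm
    rw [hV, Finset.mem_filter] at hm
    have := Finset.mem_Icc.mp (hU hm.1)
    exact ⟨hm.1, this.1, this.2, hm.2⟩
  have hgc : ∀ m ∈ V, g.coeff (m * p ^ e) = x m ^ p ^ e := by
    intro m hm
    rw [hg, Polynomial.finsetSum_coeff, Finset.sum_eq_single m]
    · simp
    · intro j _ hj
      rw [Polynomial.coeff_monomial, if_neg]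
      exact fun h => hj (Nat.eq_of_mul_eq_mul_right hpe h)
    · exact fun h => absurd hm h
  have hgs : ∀ i, g.coeff i ≠ 0 → ∃ m ∈ V, i = m * p ^ e := by
    intro i hi
    rw [hg, Polynomial.finsetSum_coeff] at hi
    obtain ⟨m, hm, hne⟩ := Finset.exists_ne_zero_of_sum_ne_zero hi
    refine ⟨m, hm, ?_⟩
    rw [Polynomial.coeff_monomial] at hne
    by_contra h
    exact hne (if_neg (Ne.symm h))
  have hweight : ∀ m ∈ V, ‖g.coeff (m * p ^ e)‖ * r ^ (m * p ^ e) = 1 := by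
    intro m hm
    rw [hgc m hm, norm_pow, pow_mul, ← mul_pow, hx m (hVI m hm).1, one_pow]
  have hg0 : g ≠ 0 := by
    obtain ⟨m, hm, hme⟩ := he
    intro h0
    have := hweight m (by rw [hV, Finset.mem_filter]; exact ⟨hm, hme⟩)
    rw [h0] at this
    simp at this
  obtain ⟨n, hn, hNn⟩ := hgs g.natDegree (by simpa using hg0)
  have hnV := hVI n hn
  rw [hsum]
  refine not_gaussLE_expComp_of_lt hπ hr ?_ ?_ ?_ ?_ hrρ
  · rw [hNn]
    exact (Nat.mul_pos hnV.2.1 hpe).ne'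
  · intro i
    rw [Polynomial.coeff_coe]
    by_cases hi : g.coeff i = 0
    · simp [hi]
    · obtain ⟨m, hm, rfl⟩ := hgs i hi
      exact (hweight m hm).le
  · rw [Polynomial.leadingCoeff, hNn]
    exact hweight n hn
  · intro i hi
    obtain ⟨m, hm, rfl⟩ := hgs i hi
    have hmV := hVI m hm
    -- Maximality of d_n = d_m = e gives n p^e ≤ D < m p^(e+1), so all exponents of g lie in (N/p,
    -- N].
    have h1 : n * p ^ e ≤ D := (le_wittLen_iff hp1 hnV.2.1 hnV.2.2.1).mp hnV.2.2.2.ge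
    have h2 : ¬ m * p ^ (e + 1) ≤ D := by
      rw [← le_wittLen_iff hp1 hmV.2.1 hmV.2.2.1, hmV.2.2.2]
      omega
    rw [hNn]
    rw [pow_succ, ← mul_assoc] at h2
    omega

/-- If `exp(f)` converges in the open unit disc, then the coordinates of `f` are integral. -/
theorem norm_le_one_of_forall_gaussLE {ζ : L}
    (hζ : IsPrimitiveRoot ζ (p ^ (wittLen p D 1 + 1))) {x : ℕ → L} {f : L⟦X⟧}
    (hf : f = ∑ m ∈ Finset.Icc 1 D, pulitaLog p D ζ (x m) m)
    (hconv : ∀ ρ : ℝ, 0 < ρ → ρ < 1 → ∃ c, GaussLE ρ c (expComp f)) :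
    ∀ m ∈ Finset.Icc 1 D, ‖x m‖ ≤ 1 := by
  by_contra hcon
  push Not at hcon
  obtain ⟨m0, hm0, hxm0⟩ := hcon
  have hζ0 := zetaAt_isPrimitiveRoot hp.out.pos hζ (Nat.zero_le _)
  rw [zero_add, pow_one] at hζ0
  have hπ := norm_sub_one_pow_eq hζ0
  have hω0 := norm_pos_of_pow_eq_prime hπ
  have hω1 := norm_lt_one_of_pow_eq_prime hπ
  -- the radius at which the coordinates become integral
  obtain ⟨r, hr0, hr1, hle, m1, hm1, hxm1⟩ : ∃ r : ℝ, 0 < r ∧ r < 1 ∧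
      (∀ m ∈ Finset.Icc 1 D, ‖x m‖ * r ^ m ≤ 1) ∧
      ∃ m ∈ Finset.Icc 1 D, ‖x m‖ * r ^ m = 1 := by
    -- r is the inverse of the maximum of the |x_m|^(1/m).
    obtain ⟨m1, hm1, hmax⟩ := Finset.exists_max_image (Finset.Icc 1 D)
      (fun m => ‖x m‖ ^ ((m : ℝ)⁻¹)) ⟨m0, hm0⟩
    set M := ‖x m1‖ ^ ((m1 : ℝ)⁻¹) with hM
    have hpow : ∀ m ∈ Finset.Icc 1 D, (‖x m‖ ^ ((m : ℝ)⁻¹)) ^ m = ‖x m‖ := fun m hm =>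
      Real.rpow_inv_natCast_pow (norm_nonneg _)
        (Nat.one_le_iff_ne_zero.mp (Finset.mem_Icc.mp hm).1)
    have hM1 : 1 < M := by
      refine lt_of_lt_of_le (Real.one_lt_rpow hxm0 ?_) (hmax m0 hm0)
      have := (Finset.mem_Icc.mp hm0).1
      positivity
    have hM0 : 0 < M := one_pos.trans hM1
    refine ⟨M⁻¹, inv_pos.mpr hM0, inv_lt_one_of_one_lt₀ hM1, fun m hm => ?_, m1, hm1, ?_⟩
    · rw [inv_pow, ← div_eq_mul_inv, div_le_one (pow_pos hM0 m), ← hpow m hm]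
      exact pow_le_pow_left₀ (by positivity) (hmax m hm) m
    · rw [inv_pow, ← div_eq_mul_inv, hM, hpow m1 hm1, div_self]
      intro h0
      rw [hM, h0, Real.zero_rpow] at hM0
      · exact lt_irrefl _ hM0
      · have := (Finset.mem_Icc.mp hm1).1
        positivity
  set U := (Finset.Icc 1 D).filter fun m => ‖x m‖ * r ^ m = 1 with hU
  set W := (Finset.Icc 1 D).filter fun m => ¬ ‖x m‖ * r ^ m = 1 with hW
  obtain ⟨m2, hm2, hmax⟩ := Finset.exists_max_image U (wittLen p D)
    ⟨m1, Finset.mem_filter.mpr ⟨hm1, hxm1⟩⟩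
  set e := wittLen p D m2 with he
  set err : ℕ → L⟦X⟧ := fun m =>
    p ^ e • pulitaLog p D ζ (x m) m - (pulitaLead p D ζ (x m) e m : L⟦X⟧) with herr
  have herr_lt : ∀ m ∈ U, ∀ i, ‖PowerSeries.coeff i (err m)‖ * r ^ i < ‖zetaAt p D ζ 0 - 1‖ := by
    intro m hm i
    have hm' := Finset.mem_filter.mp hm
    have hI := Finset.mem_Icc.mp hm'.1
    exact norm_coeff_nsmul_pulitaLog_sub_lt hζ hI.1 hI.2 hm'.2 (hmax m hm) i
  have hcont : ∀ (a : ℝ) (i : ℕ) (b : ℝ), a * r ^ i < b →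
      ∀ᶠ ρ in nhdsWithin r (Set.Ioi r), a * ρ ^ i < b := fun a i b h =>
    nhdsWithin_le_nhds (((continuous_const.mul (continuous_pow i)).tendsto r).eventually
      (gt_mem_nhds h))
  -- Finitely many strict inequalities at r persist slightly to its right; degrees above D need no
  -- condition, as the errors vanish there.
  obtain ⟨ρ, ⟨⟨hρr, hρ1⟩, hρW⟩, hρU⟩ : ∃ ρ : ℝ, ((r < ρ ∧ ρ < 1) ∧
      ∀ m ∈ W, ‖x m‖ * ρ ^ m < 1) ∧ ∀ m ∈ U, ∀ i ∈ Finset.range (D + 1),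
        ‖PowerSeries.coeff i (err m)‖ * ρ ^ i < ‖zetaAt p D ζ 0 - 1‖ := by
    refine Filter.Eventually.exists (f := nhdsWithin r (Set.Ioi r))
      (Filter.Eventually.and (Filter.Eventually.and (Filter.Eventually.and ?_ ?_) ?_) ?_)
    · exact eventually_mem_nhdsWithin
    · exact nhdsWithin_le_nhds (gt_mem_nhds hr1)
    · rw [Filter.eventually_all_finset]
      intro m hm
      have hm' := Finset.mem_filter.mp hm
      exact hcont _ _ _ (lt_of_le_of_ne (hle m hm'.1) hm'.2)
    · rw [Filter.eventually_all_finset]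
      intro m hm
      rw [Filter.eventually_all_finset]
      intro i _
      exact hcont _ _ _ (herr_lt m hm i)
  have hρ0 : 0 < ρ := hr0.trans hρr
  have hlead0 : ∀ m ∈ Finset.Icc 1 D,
      PowerSeries.constantCoeff (pulitaLead p D ζ (x m) e m : L⟦X⟧) = 0 := by
    intro m hm
    have hI := Finset.mem_Icc.mp hm
    rw [← PowerSeries.coeff_zero_eq_constantCoeff_apply, Polynomial.coeff_coe]
    refine coeff_pulitaLead_of_forall_ne ζ (x m) e fun k => ?_
    exact (Nat.mul_pos hI.1 (pow_pos hp.out.pos k)).ne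
  have hUI : U ⊆ Finset.Icc 1 D := Finset.filter_subset _ _
  have hWI : W ⊆ Finset.Icc 1 D := Finset.filter_subset _ _
  have herr0 : ∀ m ∈ U, PowerSeries.constantCoeff (err m) = 0 := by
    intro m hm
    simp only [herr, map_sub, map_nsmul, constantCoeff_pulitaLog, hlead0 m (hUI hm), smul_zero,
      sub_zero]
  have herrρ : ∀ m ∈ U, GaussLE ρ ‖zetaAt p D ζ 0 - 1‖ (err m) := by
    intro m hm i
    by_cases hi : i ∈ Finset.range (D + 1)
    · exact (hρU m hm i hi).le
    · rw [Finset.mem_range, not_lt] at hi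
      have hI := Finset.mem_Icc.mp (hUI hm)
      have h0 : PowerSeries.coeff i (err m) = 0 := by
        simp only [herr, map_sub, map_nsmul, Polynomial.coeff_coe]
        rw [coeff_pulitaLog_of_lt hζ (x m) hI.1 hI.2 (by omega),
          coeff_pulitaLead_of_lt ζ (x m) e hI.1 hI.2 (by omega)]
        simp
      rw [h0]
      simp
  have hf0 : PowerSeries.constantCoeff f = 0 := by
    rw [hf]
    exact constantCoeff_finset_sum _ fun m _ => constantCoeff_pulitaLog ζ (x m) m
  have hneg0 : ∀ m, PowerSeries.constantCoeff (-pulitaLog p D ζ (x m) m) = 0 := fun m => by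
    simp [constantCoeff_pulitaLog]
  set A : L⟦X⟧ := ∑ m ∈ W, -pulitaLog p D ζ (x m) m with hA
  set B : L⟦X⟧ := ∑ m ∈ U, -err m with hB
  have hA0 : PowerSeries.constantCoeff A = 0 := constantCoeff_finset_sum _ fun m _ => hneg0 m
  have hB0 : PowerSeries.constantCoeff B = 0 :=
    constantCoeff_finset_sum _ fun m hm => by simp [herr0 m hm]
  -- The dominant part is p^e f with the subcritical factors W and the errors removed; all three
  -- exponentials on the right are bounded at ρ.
  have hid : ((∑ m ∈ U, pulitaLead p D ζ (x m) e m : L[X]) : L⟦X⟧) =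
      p ^ e • f + (p ^ e • A + B) := by
    have h1 : f = ∑ m ∈ U, pulitaLog p D ζ (x m) m + ∑ m ∈ W, pulitaLog p D ζ (x m) m := by
      rw [hf, hU, hW, Finset.sum_filter_add_sum_filter_not]
    have h2 : ((∑ m ∈ U, pulitaLead p D ζ (x m) e m : L[X]) : L⟦X⟧) =
        ∑ m ∈ U, (pulitaLead p D ζ (x m) e m : L⟦X⟧) := by
      simp only [← Polynomial.coeToPowerSeries.ringHom_apply, map_sum]
    rw [h2, h1, hA, hB]
    simp only [herr, Finset.sum_neg_distrib, Finset.sum_sub_distrib, ← Finset.smul_sum]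
    module
  obtain ⟨c, hc⟩ := hconv ρ hρ0 hρ1
  -- Nonnegativity of the bound is required for taking powers.
  have hc' : GaussLE ρ (max c 0) (expComp f) := fun n => (hc n).trans (le_max_left _ _)
  have hbA : GaussLE ρ 1 (expComp A) := by
    rw [hA, expComp_sum _ fun m _ => hneg0 m]
    exact GaussLE.prod hρ0 _ fun m hm => gaussLE_expComp_neg_pulitaLog hζ hρ0 (hρW m hm).le
  have hbB : GaussLE ρ 1 (expComp B) :=
    GaussLE.expComp hρ0 hω0.le (pow_le_norm_factorial hω0.le hω1.le hπ) hB0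
      (GaussLE.sum hρ0 hω0.le _ fun m hm => (herrρ m hm).neg)
  refine not_gaussLE_expComp_sum_pulitaLead hζ hr0 hUI
    (fun m hm => (Finset.mem_filter.mp hm).2) ⟨m2, hm2, rfl⟩ hρr
    (c := max c 0 ^ p ^ e * (1 ^ p ^ e * 1)) ?_
  have hfp0 : PowerSeries.constantCoeff (p ^ e • f) = 0 := by rw [map_nsmul, hf0, smul_zero]
  have hAp0 : PowerSeries.constantCoeff (p ^ e • A) = 0 := by rw [map_nsmul, hA0, smul_zero]
  rw [hid, expComp_add hfp0 (by rw [map_add, hAp0, hB0, add_zero]), expComp_add hAp0 hB0,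
    expComp_nsmul hf0, expComp_nsmul hA0]
  exact (hc'.pow hρ0 (le_max_right _ _) _).mul hρ0 (by positivity) (by positivity)
    ((hbA.pow hρ0 zero_le_one _).mul hρ0 (by positivity) zero_le_one hbB)

end Converse

/-! ### Radius of convergence and the equivalences. -/

section Radius

theorem gaussLE_of_lt_convRadius {F : Type*} [NontriviallyNormedField F] {f : F⟦X⟧} {ρ : ℝ}
    (hρ : 0 < ρ) (h : ENNReal.ofReal ρ < convRadius f) : ∃ c, GaussLE ρ c f := by
  obtain ⟨c, -, hc⟩ := FormalMultilinearSeries.norm_mul_pow_le_of_lt_radius _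
    (r := ρ.toNNReal) h
  refine ⟨c, fun n => ?_⟩
  have := hc n
  rwa [FormalMultilinearSeries.ofScalars_norm, Real.coe_toNNReal ρ hρ.le] at this

theorem one_le_convRadius_of_gaussLE {F : Type*} [NontriviallyNormedField F] {f : F⟦X⟧} {c : ℝ}
    (h : GaussLE 1 c f) : 1 ≤ convRadius f := by
  refine FormalMultilinearSeries.le_radius_of_bound (r := 1) _ c fun n => ?_
  rw [FormalMultilinearSeries.ofScalars_norm]
  exact h n

end Radius

theorem coeff_tildePoly {K L : Type*} [Field K] [Field L] [Algebra K L] (p D : ℕ) (ζ : L)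
    (P : K[X]) (i : ℕ) : (tildePoly p D ζ P).coeff i = if i ∈ Finset.Icc 1 D then
      algebraMap K L (P.coeff i) / (zetaAt p D ζ (wittLen p D i) - 1) else 0 := by
  rw [tildePoly, Polynomial.finsetSum_coeff]
  simp only [Polynomial.coeff_monomial]
  rw [Finset.sum_ite_eq']

end

theorem mainTheorem3 (p : ℕ) [Fact p.Prime]
    (K : Type*) [NontriviallyNormedField K] [CharZero K] [IsUltrametricDist K]
    [NormedAlgebra ℚ_[p] K]
    (L : Type*) [NontriviallyNormedField L] [CharZero L] [IsUltrametricDist L]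
    [NormedAlgebra K L]
    (D : ℕ) (hD : 1 ≤ D)
    (ζ : L) (hζ : IsPrimitiveRoot ζ (p ^ (wittLen p D 1 + 1)))
    (P : Polynomial K) (hP0 : P.coeff 0 = 0) (hPD : P.natDegree ≤ D) :
    List.TFAE [
      1 ≤ convRadius (expComp (P : PowerSeries K)),
      ∀ m : ℕ, ‖PowerSeries.coeff m (expComp (P : PowerSeries K))‖ ≤ 1,
      ∀ m ≤ D, ‖PowerSeries.coeff m
        (expComp ((tildePoly p D ζ P : Polynomial L) : PowerSeries L))‖ ≤ 1] := by
  let _ : NormedAlgebra ℚ_[p] L :=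
    { ((algebraMap K L).comp (algebraMap ℚ_[p] K)).toAlgebra with
      norm_smul_le := fun a b => by
        change ‖algebraMap K L (algebraMap ℚ_[p] K a) * b‖ ≤ _
        rw [norm_mul, norm_algebraMap', norm_algebraMap'] }
  have hPc0 : PowerSeries.constantCoeff (P : K⟦X⟧) = 0 := by
    rw [← PowerSeries.coeff_zero_eq_constantCoeff_apply, Polynomial.coeff_coe, hP0]
  set f : L⟦X⟧ := PowerSeries.map (algebraMap K L) (P : K⟦X⟧) with hf
  have hfc : ∀ i, PowerSeries.coeff i f = algebraMap K L (P.coeff i) := fun i => by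
    rw [hf, PowerSeries.coeff_map, Polynomial.coeff_coe]
  have hf0 : PowerSeries.constantCoeff f = 0 := constantCoeff_map_eq_zero _ hPc0
  have hfD : ∀ i, D < i → PowerSeries.coeff i f = 0 := fun i hi => by
    rw [hfc, Polynomial.coeff_eq_zero_of_natDegree_lt (lt_of_le_of_lt hPD hi), map_zero]
  have hnorm : ∀ m, ‖PowerSeries.coeff m (expComp f)‖ =
      ‖PowerSeries.coeff m (expComp (P : K⟦X⟧))‖ := fun m => by
    rw [hf, ← map_expComp _ hPc0, PowerSeries.coeff_map, norm_algebraMap']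
  set x := artinHasseCoord p
    (fun i => PowerSeries.coeff i f / (zetaAt p D ζ (wittLen p D i) - 1)) with hx
  have hdec : f = ∑ m ∈ Finset.Icc 1 D, pulitaLog p D ζ (x m) m := eq_sum_pulitaLog hζ hf0 hfD
  have htilde0 : PowerSeries.constantCoeff ((tildePoly p D ζ P : L[X]) : L⟦X⟧) = 0 := by
    rw [← PowerSeries.coeff_zero_eq_constantCoeff_apply, Polynomial.coeff_coe, coeff_tildePoly]
    simp
  have h3 := norm_coeff_expComp_le_iff (p := p) htilde0 (D := D) (x := x) fun i hi => by
    rcases Nat.eq_zero_or_pos i with rfl | hi0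
    · rw [PowerSeries.coeff_zero_eq_constantCoeff_apply, htilde0,
        PowerSeries.coeff_zero_eq_constantCoeff_apply, constantCoeff_finset_sum _
          fun m _ => constantCoeff_artinHasseLogAt p (x m) m]
    · rw [hx, coeff_sum_artinHasseCoord _ hi0 hi, Polynomial.coeff_coe, coeff_tildePoly,
        if_pos (Finset.mem_Icc.mpr ⟨hi0, hi⟩), hfc]
  tfae_have 1 → 3 := by
    intro h
    rw [h3]
    refine norm_le_one_of_forall_gaussLE hζ hdec fun ρ hρ0 hρ1 => ?_
    obtain ⟨c, hc⟩ := gaussLE_of_lt_convRadius hρ0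
      (lt_of_lt_of_le (by simpa using hρ1) h)
    exact ⟨c, fun n => by rw [hnorm]; exact hc n⟩
  tfae_have 3 → 2 := by
    intro h m
    rw [h3] at h
    rw [← hnorm, hdec, expComp_sum _ fun j _ => constantCoeff_pulitaLog ζ (x j) j]
    refine gaussLE_one_left_iff.mp (GaussLE.prod one_pos _ fun j hj => ?_) m
    exact gaussLE_expComp_pulitaLog hζ one_pos (by simpa using h j hj)
  tfae_have 2 → 1 := fun h => one_le_convRadius_of_gaussLE (gaussLE_one_left_iff.mpr h)
  tfae_finish
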